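/- For an open set $\Omega\subset\mathbb{C}$ let $A^2(\Omega)$ be the Bergman space of holomorphic functions in $L^2(\Omega)$ (Lebesgue measure $dV$), a closed subspace of $L^2(\Omega)$; let $P_\Omega:L^2(\Omega)\to A^2(\Omega)$ be the orthogonal projection, $K^\Omega$ the Bergman kernel and $k^\Omega_z=K^\Omega(\cdot,z)/\sqrt{K^\Omega(z,z)}$ for $z\in\Omega$ with $K^\Omega(z,z)\neq0$. The Berezin transform of a bounded operator $T$ on $A^2(\Omega)$ is $B_\Omega T(z)=\langle Tk^\Omega_z,k^\Omega_z\rangle$. For a symbol $\phi$ on $\Omega$, the Toeplitz operator on $A^2(\Omega)$ is $T^\Omega_\phi f=P_\Omega(\phi f)$. For a function $f$ on $\Omega$, $Ef$ denotes its extension by zero. Let $\mathbb{D}^*=\{z\in\mathbb{C}:0<|z|<1\}$, let $A_r=\{z\in\mathbb{C}:r<|z|<1\}$ for $0<r<1$, and let $\phi(z)=\log|z|$. (a) For every $f\in A^2(\mathbb{D}^*)$ one has $\phi f\in L^2(\mathbb{D}^*)$, and $T_\phi=T^{\mathbb{D}^*}_\phi$ is a bounded, compact operator on $A^2(\mathbb{D}^*)$.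 The functions $e_n(z)=\sqrt{\tfrac{n+1}{\pi}}\,z^n$, $n=0,1,2,\dots$, form an orthonormal basis of $A^2(\mathbb{D}^*)$, and $T_\phi e_n=-\frac{1}{2n+2}\,e_n$ for every $n$. (b) For every $0<r<1$ the operator $T^{A_r}_\phi$ is defined on all of $A^2(A_r)$ and bounded, and for every $1\le p\le\infty$ the function $EB_{A_r}T^{A_r}_\phi$ belongs to $L^p(\mathbb{D}^*)$; nevertheless $$\lim_{r\to0^+}\bigl\|EB_{A_r}T^{A_r}_\phi\bigr\|_{L^p(\mathbb{D}^*)}=\infty\qquad\text{for every }1\le p\le\infty .$$ (c) In contrast, $B_{\mathbb{D}^*}T_\phi\in L^p(\mathbb{D}^*)$, i.e. $\|B_{\mathbb{D}^*}T_\phi\|_{L^p(\mathbb{D}^*)}<\infty$, for every $1\le p\le\infty$. -/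

import Mathlib

open MeasureTheory Set Filter Topology TopologicalSpace
open scoped ENNReal

noncomputable section

/-- The Bergman space `A²(Ω)` of an open set `Ω ⊆ ℂ`, as a subspace of `L²(Ω)` (with respect to
Lebesgue measure): the classes that have a holomorphic representative on `Ω`. -/
def bergmanSpace (Ω : Opens ℂ) : Submodule ℂ (Lp ℂ 2 (volume.restrict (Ω : Set ℂ))) where
  carrier := {f | ∃ g : ℂ → ℂ, DifferentiableOn ℂ g Ω ∧ f =ᵐ[volume.restrict (Ω : Set ℂ)] g}
  add_mem' := by
    rintro a b ⟨g, hg, hag⟩ ⟨h, hh, hbh⟩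
    exact ⟨g + h, hg.add hh, (Lp.coeFn_add a b).trans (hag.add hbh)⟩
  zero_mem' := ⟨0, differentiableOn_const 0, Lp.coeFn_zero _ _ _⟩
  smul_mem' := by
    rintro c a ⟨g, hg, hag⟩
    exact ⟨c • g, hg.const_smul c, (Lp.coeFn_smul c a).trans (hag.const_smul c)⟩

/-- The holomorphic representative on `Ω` of `f ∈ A²(Ω)`, extended by `0` outside `Ω`. -/
def bergmanFun {Ω : Opens ℂ} (f : bergmanSpace Ω) : ℂ → ℂ :=
  (Ω : Set ℂ).indicator f.2.choose

theorem bergmanFun_differentiableOn {Ω : Opens ℂ} (f : bergmanSpace Ω) :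
    DifferentiableOn ℂ (bergmanFun f) Ω :=
  f.2.choose_spec.1.congr fun _ hz => indicator_of_mem hz _

theorem bergmanFun_ae_eq {Ω : Opens ℂ} (f : bergmanSpace Ω) :
    (f : Lp ℂ 2 (volume.restrict (Ω : Set ℂ))) =ᵐ[volume.restrict (Ω : Set ℂ)] bergmanFun f := by
  refine f.2.choose_spec.2.trans ?_
  filter_upwards [ae_restrict_mem Ω.isOpen.measurableSet] with z hz
  exact (indicator_of_mem hz _).symm

theorem bergmanFun_eq_of_ae {Ω : Opens ℂ} (f : bergmanSpace Ω) {g : ℂ → ℂ}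
    (hg : ContinuousOn g Ω)
    (h : (f : Lp ℂ 2 (volume.restrict (Ω : Set ℂ))) =ᵐ[volume.restrict (Ω : Set ℂ)] g)
    {z : ℂ} (hz : z ∈ Ω) : bergmanFun f z = g z :=
  Measure.eqOn_open_of_ae_eq ((bergmanFun_ae_eq f).symm.trans h) Ω.isOpen
    (bergmanFun_differentiableOn f).continuousOn hg hz

theorem bergmanFun_of_notMem {Ω : Opens ℂ} (f : bergmanSpace Ω) {z : ℂ} (hz : z ∉ Ω) :
    bergmanFun f z = 0 := indicator_of_notMem hz _

theorem bergmanFun_add {Ω : Opens ℂ} (f g : bergmanSpace Ω) (z : ℂ) :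
    bergmanFun (f + g) z = bergmanFun f z + bergmanFun g z := by
  by_cases hz : z ∈ Ω
  · exact bergmanFun_eq_of_ae (f + g) (g := bergmanFun f + bergmanFun g)
      ((bergmanFun_differentiableOn f).add (bergmanFun_differentiableOn g)).continuousOn
      ((Lp.coeFn_add _ _).trans ((bergmanFun_ae_eq f).add (bergmanFun_ae_eq g))) hz
  · simp [bergmanFun_of_notMem _ hz]

theorem bergmanFun_smul {Ω : Opens ℂ} (c : ℂ) (f : bergmanSpace Ω) (z : ℂ) :
    bergmanFun (c • f) z = c * bergmanFun f z := by
  by_cases hz : z ∈ Ω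
  · exact bergmanFun_eq_of_ae (c • f) (g := c • bergmanFun f)
      ((bergmanFun_differentiableOn f).const_smul c).continuousOn
      ((Lp.coeFn_smul _ _).trans ((bergmanFun_ae_eq f).const_smul c)) hz
  · simp [bergmanFun_of_notMem _ hz]

theorem bergmanFun_sub {Ω : Opens ℂ} (f g : bergmanSpace Ω) (z : ℂ) :
    bergmanFun (f - g) z = bergmanFun f z - bergmanFun g z := by
  have h : f - g = f + (-1 : ℂ) • g := by rw [neg_one_smul, sub_eq_add_neg]
  rw [h, bergmanFun_add, bergmanFun_smul]
  ring

/-- The sub-mean value property on circles. -/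
theorem enorm_le_circle {g : ℂ → ℂ} {z : ℂ} {s : ℝ} (hs : 0 < s)
    (hg : DiffContOnCl ℂ g (Metric.ball z s)) :
    ∫⁻ _ in Ioo (-Real.pi) Real.pi, ‖g z‖ₑ ≤
      ∫⁻ t in Ioo (-Real.pi) Real.pi, ‖g (circleMap z s t)‖ₑ := by
  have hpi := Real.pi_pos
  have h1 : Real.circleAverage g z s = g z :=
    DiffContOnCl.circleAverage (by rwa [abs_of_pos hs])
  have h2 : (∫ t in (0 : ℝ)..(2 * Real.pi), g (circleMap z s t)) =
      ∫ t in (-Real.pi)..Real.pi, g (circleMap z s t) := by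
    have hp : Function.Periodic (fun t => g (circleMap z s t)) (2 * Real.pi) :=
      fun t => by simp only [periodic_circleMap z s t]
    have := hp.intervalIntegral_add_eq 0 (-Real.pi)
    rw [zero_add] at this
    rw [this]
    congr 1
    ring
  have h3 : (2 * Real.pi : ℝ) • g z = ∫ t in Ioo (-Real.pi) Real.pi, g (circleMap z s t) := by
    rw [← h1, Real.circleAverage, h2, smul_inv_smul₀ (by positivity),
      intervalIntegral.integral_of_le (by linarith), integral_Ioc_eq_integral_Ioo]
  calc ∫⁻ _ in Ioo (-Real.pi) Real.pi, ‖g z‖ₑ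
      = ENNReal.ofReal (2 * Real.pi) * ‖g z‖ₑ := by
        rw [setLIntegral_const, Real.volume_Ioo, mul_comm]
        congr 2
        ring
    _ = ‖(2 * Real.pi : ℝ) • g z‖ₑ := by
        rw [enorm_smul, Real.enorm_eq_ofReal (by positivity)]
    _ ≤ _ := by
        rw [h3]
        exact enorm_integral_le_lintegral_enorm _

/-- The sub-mean value property on discs. -/
theorem enorm_mul_volume_le {g : ℂ → ℂ} {z : ℂ} {ρ : ℝ}
    (hg : DifferentiableOn ℂ g (Metric.ball z ρ)) :
    volume (Metric.ball (0 : ℂ) ρ) * ‖g z‖ₑ ≤ ∫⁻ w in Metric.ball z ρ, ‖g w‖ₑ := by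
  set G : ℂ → ℝ≥0∞ := (Metric.ball (0 : ℂ) ρ).indicator fun w => ‖g (z + w)‖ₑ with hG
  set H : ℂ → ℝ≥0∞ := (Metric.ball (0 : ℂ) ρ).indicator fun _ => ‖g z‖ₑ with hH
  have e1 : ∫⁻ w in Metric.ball z ρ, ‖g w‖ₑ = ∫⁻ w, G w := by
    rw [← lintegral_indicator Metric.isOpen_ball.measurableSet,
      ← lintegral_add_left_eq_self _ z]
    refine lintegral_congr fun w => ?_
    simp [hG, indicator, Metric.mem_ball, dist_eq_norm]
  have e2 : volume (Metric.ball (0 : ℂ) ρ) * ‖g z‖ₑ = ∫⁻ w, H w := by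
    rw [hH, lintegral_indicator Metric.isOpen_ball.measurableSet, setLIntegral_const, mul_comm]
  have hcont : ContinuousOn (fun w => ‖g (z + w)‖ₑ) (Metric.ball (0 : ℂ) ρ) := by
    refine continuous_enorm.comp_continuousOn (hg.continuousOn.comp (by fun_prop) ?_)
    intro w hw
    simpa [Metric.mem_ball, dist_eq_norm] using hw
  have hGm : Measurable G := by
    classical
    have := (hcont.measurable_piecewise (g := fun _ => (0 : ℝ≥0∞)) continuousOn_const
      Metric.isOpen_ball.measurableSet)
    have hpw : (Metric.ball (0 : ℂ) ρ).piecewise (fun w => ‖g (z + w)‖ₑ) (fun _ => 0) = G := by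
      rw [hG]
      exact piecewise_eq_indicator
    rwa [hpw] at this
  have hHm : Measurable H := measurable_const.indicator Metric.isOpen_ball.measurableSet
  have hsymm : Continuous fun p : ℝ × ℝ => Complex.polarCoord.symm p := by
    simp only [Complex.polarCoord_symm_apply]
    fun_prop
  have pol : ∀ F : ℂ → ℝ≥0∞, Measurable F → ∫⁻ w, F w =
      ∫⁻ s in Ioi (0 : ℝ), ∫⁻ t in Ioo (-Real.pi) Real.pi,
        ENNReal.ofReal s * F (Complex.polarCoord.symm (s, t)) := by
    intro F hF
    rw [← Complex.lintegral_comp_polarCoord_symm, polarCoord_target, Measure.volume_eq_prod,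
      ← Measure.prod_restrict, lintegral_prod]
    · rfl
    · exact ((ENNReal.measurable_ofReal.comp measurable_fst).mul
        (hF.comp hsymm.measurable)).aemeasurable
  rw [e1, e2, pol G hGm, pol H hHm]
  refine setLIntegral_mono' measurableSet_Ioi fun s hs => ?_
  have hs' : (0 : ℝ) < s := hs
  rw [lintegral_const_mul' _ _ ENNReal.ofReal_ne_top, lintegral_const_mul' _ _ ENNReal.ofReal_ne_top]
  gcongr ENNReal.ofReal s * ?_
  have hmem : ∀ t, Complex.polarCoord.symm (s, t) ∈ Metric.ball (0 : ℂ) ρ ↔ s < ρ := by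
    intro t
    rw [mem_ball_zero_iff, Complex.norm_polarCoord_symm, abs_of_pos hs']
  by_cases hsρ : s < ρ
  · have h1 : ∀ t, H (Complex.polarCoord.symm (s, t)) = ‖g z‖ₑ := fun t =>
      indicator_of_mem ((hmem t).2 hsρ) _
    have h2 : ∀ t, G (Complex.polarCoord.symm (s, t)) = ‖g (circleMap z s t)‖ₑ := fun t => by
      rw [hG, indicator_of_mem ((hmem t).2 hsρ), Complex.polarCoord_symm_apply, circleMap,
        Complex.exp_mul_I]
      simp
    simp only [h1, h2]
    refine enorm_le_circle hs' (DifferentiableOn.diffContOnCl (hg.mono ?_))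
    exact Metric.closure_ball_subset_closedBall.trans (Metric.closedBall_subset_ball hsρ)
  · have h1 : ∀ t, H (Complex.polarCoord.symm (s, t)) = 0 := fun t =>
      indicator_of_notMem (fun h => hsρ ((hmem t).1 h)) _
    simp only [h1, lintegral_zero]
    exact zero_le

/-- Point evaluations are bounded on `A²(Ω)`, locally uniformly in the point. -/
theorem bergmanFun_bound (ρ : ℝ) (hρ : 0 < ρ) : ∃ C : ℝ, ∀ (Ω : Opens ℂ) (z : ℂ),
    Metric.ball z ρ ⊆ Ω → ∀ f : bergmanSpace Ω, ‖bergmanFun f z‖ ≤ C * ‖f‖ := by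
  set V := volume (Metric.ball (0 : ℂ) ρ) with hV
  have hV0 : V ≠ 0 := (Metric.measure_ball_pos volume _ hρ).ne'
  have hVt : V ≠ ∞ := measure_ball_lt_top.ne
  refine ⟨V.toReal⁻¹ * (V ^ ((1 : ℝ) / 2)).toReal, fun Ω z hz f => ?_⟩
  have h1 := enorm_mul_volume_le ((bergmanFun_differentiableOn f).mono hz)
  have hle : volume.restrict (Metric.ball z ρ) ≤ volume.restrict (Ω : Set ℂ) :=
    Measure.restrict_mono hz le_rfl
  have hae : (f : Lp ℂ 2 (volume.restrict (Ω : Set ℂ)))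
      =ᵐ[volume.restrict (Metric.ball z ρ)] bergmanFun f :=
    (Measure.absolutelyContinuous_of_le hle).ae_le (bergmanFun_ae_eq f)
  have hsm : AEStronglyMeasurable (bergmanFun f) (volume.restrict (Metric.ball z ρ)) :=
    (((Lp.aestronglyMeasurable (f : Lp ℂ 2 (volume.restrict (Ω : Set ℂ)))).mono_measure
      hle).congr hae)
  have h2 : ∫⁻ w in Metric.ball z ρ, ‖bergmanFun f w‖ₑ ≤ ‖f‖ₑ * V ^ ((1 : ℝ) / 2) := by
    have h3 := eLpNorm_le_eLpNorm_mul_rpow_measure_univ (p := 1) (q := 2) one_le_two hsm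
    rw [eLpNorm_one_eq_lintegral_enorm] at h3
    refine h3.trans ?_
    have hVz : (volume.restrict (Metric.ball z ρ)) univ = V := by
      rw [Measure.restrict_apply_univ, hV, Measure.addHaar_ball_center volume z]
    rw [hVz]
    have hexp : (1 / (1 : ℝ≥0∞).toReal - 1 / (2 : ℝ≥0∞).toReal : ℝ) = 1 / 2 := by norm_num
    rw [hexp]
    gcongr
    rw [← eLpNorm_congr_ae hae]
    refine (eLpNorm_mono_measure _ hle).trans_eq ?_
    exact (Lp.enorm_def _).symm
  have h4 := h1.trans h2
  have h5 := ENNReal.toReal_mono (ENNReal.mul_ne_top enorm_ne_top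
    (ENNReal.rpow_ne_top_of_nonneg (by norm_num) hVt)) h4
  rw [ENNReal.toReal_mul, ENNReal.toReal_mul, toReal_enorm, toReal_enorm] at h5
  have hVpos : 0 < V.toReal := ENNReal.toReal_pos hV0 hVt
  rw [mul_assoc, inv_mul_eq_div, le_div_iff₀ hVpos]
  linarith

/-- `A²(Ω)` is closed in `L²(Ω)`. -/
theorem bergmanSpace_isClosed (Ω : Opens ℂ) :
    IsClosed (bergmanSpace Ω : Set (Lp ℂ 2 (volume.restrict (Ω : Set ℂ)))) := by
  refine IsSeqClosed.isClosed fun u f hu hf => ?_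
  set v : ℕ → bergmanSpace Ω := fun n => ⟨u n, hu n⟩ with hv
  have hvC : CauchySeq v := by
    have := hf.cauchySeq
    rw [Metric.cauchySeq_iff] at this ⊢
    exact this
  have key : ∀ z ∈ Ω, ∃ s ∈ 𝓝 z, UniformCauchySeqOn (fun n => bergmanFun (v n)) atTop s := by
    intro z hz
    obtain ⟨ε, hε, hsub⟩ := Metric.isOpen_iff.1 Ω.isOpen z hz
    obtain ⟨C, hC⟩ := bergmanFun_bound (ε / 2) (by positivity)
    refine ⟨Metric.ball z (ε / 2), Metric.ball_mem_nhds _ (by positivity), ?_⟩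
    rw [Metric.uniformCauchySeqOn_iff]
    intro δ hδ
    obtain ⟨N, hN⟩ := Metric.cauchySeq_iff.1 hvC (δ / (|C| + 1)) (by positivity)
    refine ⟨N, fun m hm n hn x hx => ?_⟩
    have hb := hC Ω x ((Metric.ball_subset_ball' (by
      have := Metric.mem_ball.1 hx
      linarith)).trans hsub) (v m - v n)
    rw [bergmanFun_sub] at hb
    rw [dist_eq_norm]
    have hd := hN m hm n hn
    rw [dist_eq_norm, lt_div_iff₀ (by positivity)] at hd
    have : C * ‖v m - v n‖ ≤ |C| * ‖v m - v n‖ := by gcongr; exact le_abs_self C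
    nlinarith [norm_nonneg (v m - v n)]
  have lim : ∀ z ∈ Ω, ∃ l, Tendsto (fun n => bergmanFun (v n) z) atTop (𝓝 l) := by
    intro z hz
    obtain ⟨s, hs, hc⟩ := key z hz
    exact cauchySeq_tendsto_of_complete (hc.cauchySeq (mem_of_mem_nhds hs))
  classical
  set g : ℂ → ℂ := fun z => if hz : z ∈ Ω then (lim z hz).choose else 0 with hg
  have hgt : ∀ z ∈ Ω, Tendsto (fun n => bergmanFun (v n) z) atTop (𝓝 (g z)) := by
    intro z hz
    simp only [hg, dif_pos hz]
    exact (lim z hz).choose_spec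
  have hloc : TendstoLocallyUniformlyOn (fun n => bergmanFun (v n)) g atTop (Ω : Set ℂ) := by
    rw [tendstoLocallyUniformlyOn_iff_forall_isCompact Ω.isOpen] 
    intro K hKΩ hK
    rw [← tendstoLocallyUniformlyOn_iff_tendstoUniformlyOn_of_compact hK]
    intro U hU x hx
    obtain ⟨s, hs, hc⟩ := key x (hKΩ hx)
    refine ⟨s ∩ K, inter_mem (mem_nhdsWithin_of_mem_nhds hs) self_mem_nhdsWithin, ?_⟩
    exact (hc.mono inter_subset_left).tendstoUniformlyOn_of_tendsto
      (fun y hy => hgt y (hKΩ hy.2)) U hU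
  refine ⟨g, hloc.differentiableOn (Eventually.of_forall fun n =>
    bergmanFun_differentiableOn (v n)) Ω.isOpen, ?_⟩
  obtain ⟨ns, hns, hae⟩ := (tendstoInMeasure_of_tendsto_Lp hf).exists_seq_tendsto_ae
  have hall : ∀ᵐ z ∂(volume.restrict (Ω : Set ℂ)), ∀ n, (u n) z = bergmanFun (v n) z :=
    ae_all_iff.2 fun n => bergmanFun_ae_eq (v n)
  filter_upwards [hae, hall, ae_restrict_mem Ω.isOpen.measurableSet] with z h1 h2 h3
  refine tendsto_nhds_unique h1 ?_
  simp only [h2]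
  exact (hgt z h3).comp hns.tendsto_atTop

instance bergmanSpace_completeSpace (Ω : Opens ℂ) : CompleteSpace (bergmanSpace Ω) :=
  (bergmanSpace_isClosed Ω).completeSpace_coe

/-- The Bergman projection `P_Ω : L²(Ω) → A²(Ω)`, the orthogonal projection. -/
def bergmanProj (Ω : Opens ℂ) :
    Lp ℂ 2 (volume.restrict (Ω : Set ℂ)) →L[ℂ] bergmanSpace Ω :=
  (bergmanSpace Ω).orthogonalProjectionOnto

/-- Point evaluation `f ↦ f z` on `A²(Ω)` (it is `0` for `z ∉ Ω`). -/
def bergmanEval (Ω : Opens ℂ) (z : ℂ) : bergmanSpace Ω →L[ℂ] ℂ :=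
  LinearMap.mkContinuousOfExistsBound
    { toFun := fun f => bergmanFun f z
      map_add' := fun f g => bergmanFun_add f g z
      map_smul' := fun c f => bergmanFun_smul c f z } (by
    by_cases hz : z ∈ Ω
    · obtain ⟨ε, hε, hsub⟩ := Metric.isOpen_iff.1 Ω.isOpen z hz
      obtain ⟨C, hC⟩ := bergmanFun_bound ε hε
      exact ⟨C, fun f => hC Ω z hsub f⟩
    · exact ⟨0, fun f => by simp [bergmanFun_of_notMem f hz]⟩)

/-- The kernel function `K_z^Ω = K^Ω(·, z) ∈ A²(Ω)`, which represents evaluation at `z`. -/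
def bergmanKernelFun (Ω : Opens ℂ) (z : ℂ) : bergmanSpace Ω :=
  (InnerProductSpace.toDual ℂ (bergmanSpace Ω)).symm (bergmanEval Ω z)

theorem inner_bergmanKernelFun (Ω : Opens ℂ) (z : ℂ) (f : bergmanSpace Ω) :
    inner ℂ (bergmanKernelFun Ω z) f = bergmanFun f z :=
  InnerProductSpace.toDual_symm_apply

/-- The Bergman kernel `K^Ω(w, z)`. -/
def bergmanKernel (Ω : Opens ℂ) (w z : ℂ) : ℂ := bergmanFun (bergmanKernelFun Ω z) w

/-- The normalized kernel `k_z^Ω = K^Ω(·, z) / √K^Ω(z, z) ∈ A²(Ω)`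
(`K^Ω(z, z)` is a non-negative real number). -/
def normalizedBergmanKernel (Ω : Opens ℂ) (z : ℂ) : bergmanSpace Ω :=
  ((Real.sqrt (bergmanKernel Ω z z).re : ℂ))⁻¹ • bergmanKernelFun Ω z

/-- The Berezin transform `B_Ω T(z) = ⟨T k_z, k_z⟩` of a bounded operator `T` on `A²(Ω)`.
(Mathlib's inner product is linear in the second argument.) -/
def berezin (Ω : Opens ℂ) (T : bergmanSpace Ω →L[ℂ] bergmanSpace Ω) (z : ℂ) : ℂ :=
  inner ℂ (normalizedBergmanKernel Ω z) (T (normalizedBergmanKernel Ω z))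

/-- The bounded operator `T` on `A²(Ω)` is the Toeplitz operator with symbol `φ`: for every
`f ∈ A²(Ω)` one has `φ f ∈ L²(Ω)` and `T f = P_Ω (φ f)`. -/
def IsToeplitzOperator (Ω : Opens ℂ) (φ : ℂ → ℂ)
    (T : bergmanSpace Ω →L[ℂ] bergmanSpace Ω) : Prop :=
  ∀ f : bergmanSpace Ω,
    ∃ h : MemLp (fun w => φ w * bergmanFun f w) 2 (volume.restrict (Ω : Set ℂ)),
      T f = bergmanProj Ω (h.toLp _)

theorem IsToeplitzOperator.unique {Ω : Opens ℂ} {φ : ℂ → ℂ}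
    {S T : bergmanSpace Ω →L[ℂ] bergmanSpace Ω}
    (hS : IsToeplitzOperator Ω φ S) (hT : IsToeplitzOperator Ω φ T) : S = T := by
  ext1 f
  obtain ⟨_, h1⟩ := hS f
  obtain ⟨_, h2⟩ := hT f
  rw [h1, h2]

open Classical in
/-- The Toeplitz operator `T_φ = P_Ω M_φ` on `A²(Ω)`. It is the unique operator with
`IsToeplitzOperator Ω φ` whenever there is one, and `0` by convention otherwise. -/
def toeplitz (Ω : Opens ℂ) (φ : ℂ → ℂ) : bergmanSpace Ω →L[ℂ] bergmanSpace Ω :=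
  if h : ∃ T, IsToeplitzOperator Ω φ T then h.choose else 0

/-- The symbol `φ(z) = log |z|`. -/
def logSymbol (z : ℂ) : ℂ := (Real.log ‖z‖ : ℂ)

/-- The punctured unit disc `𝔻* = 𝔻 ∖ {0}`. -/
def puncturedDisc : Opens ℂ :=
  ⟨Metric.ball (0 : ℂ) 1 \ {0}, Metric.isOpen_ball.sdiff isClosed_singleton⟩

/-- The annulus `A_r = {z : r < |z| < 1}`. -/
def annulus (r : ℝ) : Opens ℂ :=
  ⟨{z : ℂ | r < ‖z‖ ∧ ‖z‖ < 1},
    (isOpen_lt continuous_const continuous_norm).inter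
      (isOpen_lt continuous_norm continuous_const)⟩

/-- The extension `E f` of a function on `Ω` by zero. -/
def zeroExtension (Ω : Opens ℂ) (f : ℂ → ℂ) : ℂ → ℂ := (Ω : Set ℂ).indicator f

end

/-! On an annulus `r < |z| < 1` the monomials `zⁿ` that are square-integrable form an orthogonal
basis of the Bergman space: all `n ∈ ℤ` if `r > 0`, only `n ≥ 0` if `r = 0`, which is the punctured
disc. A radial symbol acts diagonally, the eigenvalue at `n` being the mean of the symbol against
the weight `s^(2n+1)` on `(r, 1)` (`exists_hilbertBasis_monomials`). For `log |z|` and `r = 0` the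
eigenvalues are `-1/(2n+2) → 0`, whence compactness (`isCompactOperator_of_diagonal`).

For `r > 0` the blow-up comes from the mode `n = -1`, which the punctured disc does not have. Put `L
= log (1/r)`. Then `‖z⁻¹‖² = 2πL` and the eigenvalue is `-L/2`, so this mode contributes
`-|z|⁻²/(4π)` to `⟨T K_z, K_z⟩`, independently of `r`. All eigenvalues are `≤ 0`, so nothing cancels
it (`le_norm_berezin_annulus`). On the other hand `K(z,z) ≤ C + |z|⁻²/(2πL)` for `√r ≤ |z| ≤ 1/2`
(`exists_norm_bergmanKernelFun_annulus_sq_le`), which is bounded once `|z| ≥ L^(-1/2)`. So `|B T|`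
is at least a constant times `|z|⁻²` on `L^(-1/2) < |z| < 1/2`, and the integral of this grows like
`log √L`. Hölder's inequality passes from `L¹` to `L^p`.

The finiteness claims all follow from `|B T| ≤ ‖T‖` on a set of finite measure. -/

noncomputable section

/-! ### Laurent coefficients on annuli -/

/-- Integration in polar coordinates over a round annulus. -/
theorem integral_annulus_eq_circleAverage {a b : ℝ} (ha : 0 ≤ a) (hab : a ≤ b) {F : ℂ → ℂ}
    (hc : ContinuousOn F {w : ℂ | a < ‖w‖ ∧ ‖w‖ < b})
    (hi : IntegrableOn F {w : ℂ | a < ‖w‖ ∧ ‖w‖ < b}) :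
    ∫ w in {w : ℂ | a < ‖w‖ ∧ ‖w‖ < b}, F w =
      2 * Real.pi * ∫ s in a..b, s * Real.circleAverage F 0 s := by
  set S : Set ℂ := {w : ℂ | a < ‖w‖ ∧ ‖w‖ < b} with hS
  have hSo : IsOpen S := (isOpen_lt continuous_const continuous_norm).inter
    (isOpen_lt continuous_norm continuous_const)
  set G : ℂ → ℂ := S.indicator F with hG
  have hGm : Measurable G := by
    classical
    have := hc.measurable_piecewise (g := fun _ => (0 : ℂ)) continuousOn_const hSo.measurableSet
    rwa [show S.piecewise F (fun _ => 0) = G from piecewise_eq_indicator] at this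
  have hGi : Integrable G := (integrable_indicator_iff hSo.measurableSet).2 hi
  have hsymm : Measurable fun p : ℝ × ℝ => Complex.polarCoord.symm p := by
    simp only [Complex.polarCoord_symm_apply]
    fun_prop
  have hint : IntegrableOn (fun p : ℝ × ℝ => p.1 • G (Complex.polarCoord.symm p))
      (Ioi (0 : ℝ) ×ˢ Ioo (-Real.pi) Real.pi) := by
    refine ⟨(measurable_fst.smul (hGm.comp hsymm)).aestronglyMeasurable, ?_⟩
    rw [hasFiniteIntegral_iff_enorm]
    have h1 := Complex.lintegral_comp_polarCoord_symm fun w => ‖G w‖ₑ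
    have h2 := hasFiniteIntegral_iff_enorm.1 hGi.2
    rw [← h1, polarCoord_target] at h2
    refine lt_of_eq_of_lt ?_ h2
    refine setLIntegral_congr_fun (measurableSet_Ioi.prod measurableSet_Ioo) fun p hp => ?_
    simp only [enorm_smul, smul_eq_mul]
    rw [Real.enorm_eq_ofReal (le_of_lt hp.1)]
  rw [← integral_indicator hSo.measurableSet, ← Complex.integral_comp_polarCoord_symm,
    polarCoord_target, Measure.volume_eq_prod, setIntegral_prod _ hint,
    intervalIntegral.integral_of_le hab, integral_Ioc_eq_integral_Ioo,
    ← integral_const_mul]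
  have key : ∀ s ∈ Ioi (0 : ℝ),
      ∫ t in Ioo (-Real.pi) Real.pi, s • G (Complex.polarCoord.symm (s, t)) =
        (Ioo a b).indicator
          (fun s : ℝ => 2 * Real.pi * ((s : ℂ) * Real.circleAverage F 0 s)) s := by
    intro s hs
    have hs' : (0 : ℝ) < s := hs
    have hcm : ∀ t : ℝ, Complex.polarCoord.symm (s, t) = circleMap 0 s t := fun t => by
      rw [Complex.polarCoord_symm_apply, circleMap, Complex.exp_mul_I]
      simp
    have hn : ∀ t, ‖circleMap 0 s t‖ = s := fun t => by simp [abs_of_pos hs']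
    by_cases hsab : s ∈ Ioo a b
    · rw [indicator_of_mem hsab, integral_smul,
        Real.circleAverage_eq_integral_add (-Real.pi), Complex.real_smul, Complex.real_smul,
        intervalIntegral.integral_comp_add_right (fun θ => F (circleMap 0 s θ)),
        intervalIntegral.integral_of_le (by linarith [Real.pi_pos]),
        integral_Ioc_eq_integral_Ioo]
      have : ∀ t, G (Complex.polarCoord.symm (s, t)) = F (circleMap 0 s t) := fun t => by
        rw [hcm, hG, indicator_of_mem]
        exact ⟨by rw [hn]; exact hsab.1, by rw [hn]; exact hsab.2⟩
      simp only [this]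
      have e1 : (0 : ℝ) + -Real.pi = -Real.pi := by ring
      have e2 : 2 * Real.pi + -Real.pi = Real.pi := by ring
      rw [e1, e2]
      have := Real.pi_ne_zero
      push_cast
      field_simp
    · rw [indicator_of_notMem hsab]
      have : ∀ t, G (Complex.polarCoord.symm (s, t)) = 0 := fun t => by
        rw [hcm, hG, indicator_of_notMem]
        rintro ⟨h1, h2⟩
        rw [hn] at h1 h2
        exact hsab ⟨h1, h2⟩
      simp only [this, smul_zero, integral_zero]
  rw [setIntegral_congr_fun measurableSet_Ioi key, setIntegral_indicator measurableSet_Ioo]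
  congr 2
  ext s
  simp only [mem_inter_iff, mem_Ioi, mem_Ioo]
  exact ⟨fun h => h.2, fun h => ⟨ha.trans_lt h.1, h⟩⟩

/-- The average is `(2πi)⁻¹ ∮ g(w)/w dw`, and `g(w)/w` is holomorphic between the two circles, so
Cauchy's theorem applies. -/
theorem circleAverage_eq_of_differentiableOn {r : ℝ} (hr : 0 ≤ r) {g : ℂ → ℂ}
    (hg : DifferentiableOn ℂ g (annulus r)) {s t : ℝ} (hs : s ∈ Ioo r 1) (ht : t ∈ Ioo r 1) :
    Real.circleAverage g 0 s = Real.circleAverage g 0 t := by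
  wlog hst : s ≤ t generalizing s t
  · exact (this ht hs (le_of_not_ge hst)).symm
  have hs0 : 0 < s := hr.trans_lt hs.1
  have ht0 : 0 < t := hr.trans_lt ht.1
  rw [Real.circleAverage_eq_circleIntegral hs0.ne', Real.circleAverage_eq_circleIntegral ht0.ne']
  congr 1
  have hsub : Metric.closedBall (0 : ℂ) t \ Metric.ball 0 s ⊆ annulus r := fun z hz => by
    have h1 := hz.1
    have h2 := hz.2
    simp only [Metric.mem_closedBall, dist_zero_right, Metric.mem_ball, not_lt] at h1 h2
    exact ⟨hs.1.trans_le h2, h1.trans_lt ht.2⟩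
  refine (Complex.circleIntegral_sub_center_inv_smul_eq_of_differentiable_on_annulus_off_countable
    hs0 hst countable_empty (hg.continuousOn.mono hsub) fun z hz => ?_).symm
  exact hg.differentiableAt ((annulus r).isOpen.mem_nhds (hsub
    ⟨Metric.ball_subset_closedBall hz.1.1, fun h => hz.1.2 (Metric.ball_subset_closedBall h)⟩))

/-- The `n`-th Laurent coefficient of a holomorphic function on the annulus `annulus r`. -/
def laurentCoeff (r : ℝ) (f : ℂ → ℂ) (n : ℤ) : ℂ :=
  Real.circleAverage (fun w => f w * w ^ (-n)) 0 ((r + 1) / 2)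

theorem ne_zero_of_mem_annulus {r : ℝ} (hr : 0 ≤ r) {w : ℂ} (hw : w ∈ annulus r) : w ≠ 0 :=
  norm_pos_iff.1 (hr.trans_lt hw.1)

theorem differentiableOn_zpow_annulus {r : ℝ} (hr : 0 ≤ r) (n : ℤ) :
    DifferentiableOn ℂ (fun w : ℂ => w ^ n) (annulus r) := fun _ hw =>
  (differentiableAt_zpow.2 (Or.inl (ne_zero_of_mem_annulus hr hw))).differentiableWithinAt

/-- The radius `(r + 1) / 2` in `laurentCoeff` is an arbitrary choice; any radius in `(r, 1)`
serves. -/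
theorem circleAverage_mul_zpow {r : ℝ} (hr : 0 ≤ r) {f : ℂ → ℂ}
    (hf : DifferentiableOn ℂ f (annulus r)) (n : ℤ) {s : ℝ} (hs : s ∈ Ioo r 1) :
    Real.circleAverage (fun w => f w * w ^ (-n)) 0 s = laurentCoeff r f n :=
  circleAverage_eq_of_differentiableOn hr (hf.mul (differentiableOn_zpow_annulus hr (-n))) hs
    ⟨by linarith [hs.1.trans hs.2], by linarith [hs.1.trans hs.2]⟩

/-- On a circle about `0` this turns the pairing with `wⁿ` into the integral that defines the `n`-th
Laurent coefficient. -/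
theorem conj_zpow_eq {w : ℂ} (hw : w ≠ 0) (n : ℤ) :
    (starRingEnd ℂ) (w ^ n) = ((‖w‖ ^ (2 * n) : ℝ) : ℂ) * w ^ (-n) := by
  have h1 : (starRingEnd ℂ) w = ((‖w‖ ^ 2 : ℝ) : ℂ) * w⁻¹ := by
    rw [Complex.ofReal_pow, ← Complex.mul_conj', mul_comm w, mul_inv_cancel_right₀ hw]
  rw [map_zpow₀, h1, mul_zpow, inv_zpow, zpow_neg, zpow_mul]
  push_cast
  rfl

/-- Pairing `h(|w|) f(w)` with `wⁿ` over the annulus only sees the `n`-th Laurent coefficient. -/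
theorem integral_radial_mul_conj_zpow {r : ℝ} (hr : 0 ≤ r) (hr1 : r < 1) {f : ℂ → ℂ}
    (hf : DifferentiableOn ℂ f (annulus r)) (n : ℤ) {h : ℝ → ℝ} (hh : ContinuousOn h (Ioo r 1))
    (hi : IntegrableOn (fun w => (starRingEnd ℂ) (w ^ n) * (h ‖w‖ * f w)) (annulus r)) :
    ∫ w in (annulus r : Set ℂ), (starRingEnd ℂ) (w ^ n) * (h ‖w‖ * f w) =
      (2 * Real.pi * ∫ s in r..1, s ^ (2 * n + 1) * h s : ℝ) * laurentCoeff r f n := by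
  have hc : ContinuousOn (fun w => (starRingEnd ℂ) (w ^ n) * (h ‖w‖ * f w)) (annulus r) := by
    refine ContinuousOn.mul (Complex.continuous_conj.comp_continuousOn
      (differentiableOn_zpow_annulus hr n).continuousOn) (ContinuousOn.mul ?_ hf.continuousOn)
    exact Complex.continuous_ofReal.comp_continuousOn
      (hh.comp continuous_norm.continuousOn fun w hw => hw)
  refine (integral_annulus_eq_circleAverage hr hr1.le hc hi).trans ?_
  push_cast
  rw [mul_assoc, mul_assoc, mul_assoc]
  congr 2
  rw [← intervalIntegral.integral_ofReal, ← intervalIntegral.integral_mul_const,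
    intervalIntegral.integral_of_le hr1.le, intervalIntegral.integral_of_le hr1.le,
    integral_Ioc_eq_integral_Ioo, integral_Ioc_eq_integral_Ioo]
  refine setIntegral_congr_fun measurableSet_Ioo fun s hs => ?_
  have hs0 : 0 < s := hr.trans_lt hs.1
  have h1 : Real.circleAverage (fun w => (starRingEnd ℂ) (w ^ n) * (h ‖w‖ * f w)) 0 s =
      Real.circleAverage (((s ^ (2 * n) * h s : ℝ) : ℂ) • fun w => f w * w ^ (-n)) 0 s := by
    refine Real.circleAverage_congr_sphere fun w hw => ?_
    have hws : ‖w‖ = s := by simpa [abs_of_pos hs0] using hw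
    have hw0 : w ≠ 0 := norm_pos_iff.1 (hws ▸ hs0)
    simp only [Pi.smul_apply, smul_eq_mul]
    rw [conj_zpow_eq hw0, hws]
    push_cast
    ring
  rw [h1, Real.circleAverage_smul, circleAverage_mul_zpow hr hf n hs, zpow_add_one₀ hs0.ne']
  simp only [smul_eq_mul]
  push_cast
  ring

/-- Restricted to a circle, the Laurent series is a Fourier series; uniqueness of Laurent
coefficients is thereby reduced to Fourier theory. -/
theorem fourierCoeff_circle_eq {r : ℝ} (hr : 0 ≤ r) {f : ℂ → ℂ}
    (hf : DifferentiableOn ℂ f (annulus r)) {s : ℝ} (hs : s ∈ Ioo r 1) (n : ℤ) :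
    haveI : Fact (0 < 2 * Real.pi) := ⟨Real.two_pi_pos⟩
    fourierCoeff (fun x : AddCircle (2 * Real.pi) => f (s * fourier 1 x)) n =
      s ^ n * laurentCoeff r f n := by
  have : Fact (0 < 2 * Real.pi) := ⟨Real.two_pi_pos⟩
  have hs0 : 0 < s := hr.trans_lt hs.1
  have hs0' : (s : ℂ) ≠ 0 := Complex.ofReal_ne_zero.2 hs0.ne'
  rw [fourierCoeff_eq_intervalIntegral _ n 0, ← circleAverage_mul_zpow hr hf n hs,
    Real.circleAverage_def, zero_add, mul_smul_comm, ← intervalIntegral.integral_const_mul, one_div]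
  congr 1
  refine intervalIntegral.integral_congr fun t _ => ?_
  have h1 : (s : ℂ) * fourier 1 (t : AddCircle (2 * Real.pi)) = circleMap 0 s t := by
    rw [fourier_coe_apply, circleMap, zero_add]
    congr 2
    have := Real.pi_ne_zero
    push_cast
    field_simp
  have h2 : fourier (-n) (t : AddCircle (2 * Real.pi)) =
      (s : ℂ) ^ n * circleMap 0 s t ^ (-n) := by
    rw [← h1, mul_zpow, ← mul_assoc, ← zpow_add₀ hs0', add_neg_cancel, zpow_zero, one_mul,
      fourier_coe_apply, fourier_coe_apply, ← Complex.exp_int_mul]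
    congr 1
    push_cast
    ring
  simp only [smul_eq_mul]
  rw [h1, h2]
  ring

/-- A holomorphic function on an annulus all of whose Laurent coefficients vanish is zero. -/
theorem eq_zero_of_laurentCoeff_eq_zero {r : ℝ} (hr : 0 ≤ r) {f : ℂ → ℂ}
    (hf : DifferentiableOn ℂ f (annulus r)) (h : ∀ n, laurentCoeff r f n = 0) {z : ℂ}
    (hz : z ∈ annulus r) : f z = 0 := by
  have : Fact (0 < 2 * Real.pi) := ⟨Real.two_pi_pos⟩
  have hs : ‖z‖ ∈ Ioo r 1 := hz
  have hs0 : 0 < ‖z‖ := hr.trans_lt hs.1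
  have hcont : Continuous fun x : AddCircle (2 * Real.pi) => f (‖z‖ * fourier 1 x) := by
    refine hf.continuousOn.comp_continuous (by fun_prop) fun x => ?_
    have : ‖(‖z‖ : ℂ) * fourier 1 x‖ = ‖z‖ := by
      rw [fourier_one, norm_mul, Circle.norm_coe]; simp
    exact ⟨by rw [this]; exact hs.1, by rw [this]; exact hs.2⟩
  have h0 : fourierCoeff (fun x : AddCircle (2 * Real.pi) => f (‖z‖ * fourier 1 x)) = 0 := by
    ext n
    rw [fourierCoeff_circle_eq hr hf hs n, h n, mul_zero, Pi.zero_apply]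
  -- Vanishing coefficients are summable, so the Fourier series of this continuous function
  -- converges to it pointwise, and its sum is zero.
  have hsum : Summable (fourierCoeff (⟨_, hcont⟩ : C(AddCircle (2 * Real.pi), ℂ))) := by
    change Summable (fourierCoeff (fun x : AddCircle (2 * Real.pi) => f (‖z‖ * fourier 1 x)))
    rw [h0]
    exact summable_zero
  have h1 := has_pointwise_sum_fourier_series_of_summable hsum (z.arg : AddCircle (2 * Real.pi))
  have h2 : (fun i => fourierCoeff (⟨_, hcont⟩ : C(AddCircle (2 * Real.pi), ℂ)) i •
      fourier i (z.arg : AddCircle (2 * Real.pi))) = fun _ => 0 := by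
    ext i
    have := congrFun h0 i
    change fourierCoeff (fun x : AddCircle (2 * Real.pi) => f (‖z‖ * fourier 1 x)) i • _ = _
    rw [this]
    simp
  rw [h2] at h1
  have h3 := h1.unique hasSum_zero
  change f (‖z‖ * fourier 1 (z.arg : AddCircle (2 * Real.pi))) = 0 at h3
  rw [fourier_coe_apply] at h3
  rw [← h3]
  congr 1
  rw [eq_comm]
  convert! Complex.norm_mul_exp_arg_mul_I z using 3
  have := Real.pi_ne_zero
  push_cast
  field_simp

/-! ### Monomials in the Bergman space of an annulus -/

/-- The element of `A²(Ω)` given by a square-integrable holomorphic function on `Ω`. -/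
def bergmanMk {Ω : Opens ℂ} {g : ℂ → ℂ} (hg : DifferentiableOn ℂ g Ω)
    (h : MemLp g 2 (volume.restrict (Ω : Set ℂ))) : bergmanSpace Ω :=
  ⟨h.toLp g, g, hg, h.coeFn_toLp⟩

theorem bergmanFun_bergmanMk {Ω : Opens ℂ} {g : ℂ → ℂ} (hg : DifferentiableOn ℂ g Ω)
    (h : MemLp g 2 (volume.restrict (Ω : Set ℂ))) {z : ℂ} (hz : z ∈ Ω) :
    bergmanFun (bergmanMk hg h) z = g z :=
  bergmanFun_eq_of_ae _ hg.continuousOn h.coeFn_toLp hz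

theorem memLp_bergmanFun {Ω : Opens ℂ} (f : bergmanSpace Ω) :
    MemLp (bergmanFun f) 2 (volume.restrict (Ω : Set ℂ)) :=
  (Lp.memLp (f : Lp ℂ 2 (volume.restrict (Ω : Set ℂ)))).ae_eq (bergmanFun_ae_eq f)

theorem toLp_bergmanFun {Ω : Opens ℂ} (f : bergmanSpace Ω) :
    (memLp_bergmanFun f).toLp _ = (f : Lp ℂ 2 (volume.restrict (Ω : Set ℂ))) :=
  Lp.ext ((memLp_bergmanFun f).coeFn_toLp.trans (bergmanFun_ae_eq f).symm)

theorem inner_bergmanProj {Ω : Opens ℂ} (u : bergmanSpace Ω)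
    (v : Lp ℂ 2 (volume.restrict (Ω : Set ℂ))) :
    inner ℂ u (bergmanProj Ω v) = inner ℂ (u : Lp ℂ 2 (volume.restrict (Ω : Set ℂ))) v :=
  Submodule.inner_orthogonalProjectionOnto_eq_of_mem_left u v

theorem inner_toLp_toLp {μ : Measure ℂ} {g k : ℂ → ℂ} (hg : MemLp g 2 μ) (hk : MemLp k 2 μ) :
    inner ℂ (hg.toLp g) (hk.toLp k) = ∫ w, (starRingEnd ℂ) (g w) * k w ∂μ := by
  rw [L2.inner_def]
  refine integral_congr_ae ?_
  filter_upwards [hg.coeFn_toLp, hk.coeFn_toLp] with w h1 h2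
  rw [h1, h2, RCLike.inner_apply, mul_comm]

theorem inner_zpow_toLp_radial {r : ℝ} (hr : 0 ≤ r) (hr1 : r < 1) {n : ℤ}
    (hn : MemLp (fun w : ℂ => w ^ n) 2 (volume.restrict (annulus r : Set ℂ))) {f : ℂ → ℂ}
    (hf : DifferentiableOn ℂ f (annulus r)) {h : ℝ → ℝ} (hh : ContinuousOn h (Ioo r 1))
    (hk : MemLp (fun w => h ‖w‖ * f w) 2 (volume.restrict (annulus r : Set ℂ))) :
    inner ℂ (hn.toLp _) (hk.toLp _) =
      (2 * Real.pi * ∫ s in r..1, s ^ (2 * n + 1) * h s : ℝ) * laurentCoeff r f n := by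
  rw [inner_toLp_toLp, integral_radial_mul_conj_zpow hr hr1 hf n hh]
  exact hn.star.integrable_mul hk

/-- The squared norm `‖wⁿ‖²` in `A²(annulus r)`. -/
def monomialNormSq (r : ℝ) (n : ℤ) : ℝ := 2 * Real.pi * ∫ s in r..1, s ^ (2 * n + 1)

theorem inner_zpow_toLp {r : ℝ} (hr : 0 ≤ r) (hr1 : r < 1) {n : ℤ}
    (hn : MemLp (fun w : ℂ => w ^ n) 2 (volume.restrict (annulus r : Set ℂ))) {f : ℂ → ℂ}
    (hf : DifferentiableOn ℂ f (annulus r))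
    (hk : MemLp f 2 (volume.restrict (annulus r : Set ℂ))) :
    inner ℂ (hn.toLp _) (hk.toLp _) = monomialNormSq r n * laurentCoeff r f n := by
  have h1 : (fun w => (((fun _ => 1 : ℝ → ℝ) ‖w‖ : ℝ) : ℂ) * f w) = f := by simp
  have := inner_zpow_toLp_radial hr hr1 hn hf (h := fun _ => 1) continuousOn_const
    (by rwa [h1])
  simp only [mul_one] at this
  rw [monomialNormSq, ← this]
  congr 2
  exact h1.symm

theorem laurentCoeff_zpow {r : ℝ} (hr : 0 ≤ r) (m n : ℤ) :
    laurentCoeff r (fun w => w ^ m) n = if m = n then 1 else 0 := by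
  have hR : 0 < (r + 1) / 2 := by positivity
  have h0 : ∀ w ∈ Metric.sphere (0 : ℂ) ((r + 1) / 2), w ≠ 0 := fun w hw => by
    rw [mem_sphere_zero_iff_norm] at hw
    exact norm_pos_iff.1 (hw ▸ hR)
  rw [laurentCoeff]
  split_ifs with h
  · subst h
    rw [Real.circleAverage_congr_sphere (f₂ := fun _ => 1), Real.circleAverage_const]
    intro w hw
    rw [abs_of_pos hR] at hw
    simp only
    rw [← zpow_add₀ (h0 w hw), add_neg_cancel, zpow_zero]
  · rw [Real.circleAverage_eq_circleIntegral hR.ne',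
      circleIntegral.integral_congr hR.le (g := fun z => (z - 0) ^ (m - n - 1)),
      circleIntegral.integral_sub_zpow_of_ne (by omega), smul_zero]
    intro w hw
    simp only [sub_zero, smul_eq_mul]
    rw [← zpow_add₀ (h0 w hw), ← zpow_neg_one, ← zpow_add₀ (h0 w hw)]
    congr 1
    ring

instance isFiniteMeasure_annulus (r : ℝ) :
    IsFiniteMeasure (volume.restrict (annulus r : Set ℂ)) := by
  refine ⟨?_⟩
  rw [Measure.restrict_apply_univ]
  refine (measure_mono fun z hz => ?_).trans_lt
    (measure_ball_lt_top (μ := volume) (x := (0 : ℂ)) (r := 1))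
  exact mem_ball_zero_iff.2 hz.2

/-- The alternative `0 < r ∨ 0 ≤ n` singles out exactly the square-integrable monomials. For `n < 0`
the bound `r ^ n` comes from the inner circle. -/
theorem memLp_zpow_annulus {r : ℝ} (hr : 0 ≤ r) {n : ℤ} (hn : 0 < r ∨ 0 ≤ n) :
    MemLp (fun w : ℂ => w ^ n) 2 (volume.restrict (annulus r : Set ℂ)) := by
  refine MemLp.of_bound ((differentiableOn_zpow_annulus hr n).continuousOn.aestronglyMeasurable
    (annulus r).isOpen.measurableSet) (max 1 (r ^ n)) ?_
  filter_upwards [ae_restrict_mem (annulus r).isOpen.measurableSet] with w hw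
  rw [norm_zpow]
  have hw0 : 0 < ‖w‖ := hr.trans_lt hw.1
  rcases le_or_gt 0 n with h | h
  · exact (zpow_le_one₀ hw0 hw.2.le h).trans (le_max_left _ _)
  · have hr0 : 0 < r := hn.resolve_right (not_le.2 h)
    refine le_trans ?_ (le_max_right _ _)
    have := zpow_le_zpow_left₀ (n := -n) (by omega) hr hw.1.le
    rw [zpow_neg, zpow_neg] at this
    exact (inv_le_inv₀ (zpow_pos hr0 _) (zpow_pos hw0 _)).1 this

theorem intervalIntegrable_zpow_of {r : ℝ} (hr1 : r < 1) {n : ℤ}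
    (hn : 0 < r ∨ 0 ≤ n) : IntervalIntegrable (fun s : ℝ => s ^ n) volume r 1 := by
  refine ContinuousOn.intervalIntegrable fun s hs => ?_
  rw [uIcc_of_le hr1.le] at hs
  refine (continuousAt_zpow₀ s n ?_).continuousWithinAt
  exact hn.imp (fun h => (h.trans_le hs.1).ne') id

theorem monomialNormSq_pos {r : ℝ} (hr : 0 ≤ r) (hr1 : r < 1) {n : ℤ} (hn : 0 < r ∨ 0 ≤ n) :
    0 < monomialNormSq r n := by
  refine mul_pos Real.two_pi_pos (intervalIntegral.intervalIntegral_pos_of_pos_on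
    (intervalIntegrable_zpow_of hr1 (hn.imp id fun h => by omega)) (fun s hs => ?_) hr1)
  exact zpow_pos (hr.trans_lt hs.1) _

/-- The one exponent whose norm is logarithmic in `r`; both the missing principal part on the
punctured disc and the blow-up on annuli rest on it. -/
theorem monomialNormSq_neg_one {r : ℝ} (hr : 0 < r) :
    monomialNormSq r (-1) = 2 * Real.pi * Real.log r⁻¹ := by
  rw [monomialNormSq]
  have : ∀ s : ℝ, s ^ (2 * (-1) + 1 : ℤ) = s⁻¹ := fun s => by norm_num
  simp only [this]
  rw [integral_inv_of_pos hr one_pos, one_div]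

theorem monomialNormSq_of_ne {r : ℝ} {n : ℤ} (hn : 0 < r ∧ n ≠ -1 ∨ 0 ≤ n) :
    monomialNormSq r n = Real.pi * (1 - r ^ (2 * n + 2)) / (n + 1) := by
  rw [monomialNormSq, integral_zpow]
  · have h1 : (n : ℝ) + 1 ≠ 0 := by
      have : n + 1 ≠ 0 := by rcases hn with h | h <;> omega
      exact_mod_cast this
    have h2 : (2 * n + 1 + 1 : ℝ) ≠ 0 := by
      rw [show (2 * n + 1 + 1 : ℝ) = 2 * (n + 1) by ring]
      positivity
    rw [one_zpow, show 2 * n + 1 + 1 = 2 * n + 2 by ring]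
    push_cast
    field_simp
    ring
  · rcases hn with ⟨h, h'⟩ | h
    · refine Or.inr ⟨by omega, fun h0 => ?_⟩
      rw [mem_uIcc] at h0
      rcases h0 with h0 | h0 <;> linarith [h0.1, h0.2]
    · exact Or.inl (by omega)

/-- On the punctured disc, a square-integrable holomorphic function has no principal part. -/
theorem laurentCoeff_eq_zero_of_neg (f : bergmanSpace (annulus 0)) {n : ℤ} (hn : n < 0) :
    laurentCoeff 0 (bergmanFun f) n = 0 := by
  set c := laurentCoeff 0 (bergmanFun f) n with hc
  -- Cauchy–Schwarz for `wⁿ` and `f` on the annulus of inner radius `ε` gives `‖wⁿ‖² |c|² ≤ ‖f‖²`.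
  -- Since `s^(2n+1) ≥ s⁻¹` for `s ≤ 1` and `n ≤ -1`, `‖wⁿ‖²` is at least `‖w⁻¹‖² = 2π log (1/ε)`,
  -- which is unbounded as `ε → 0`.
  have hle : ∀ ε ∈ Ioo (0 : ℝ) 1, 2 * Real.pi * Real.log ε⁻¹ * ‖c‖ ^ 2 ≤ ‖f‖ ^ 2 := by
    intro ε hε
    have hsub : (annulus ε : Set ℂ) ⊆ annulus 0 := fun z hz => ⟨hε.1.trans hz.1, hz.2⟩
    have hd : DifferentiableOn ℂ (bergmanFun f) (annulus ε) :=
      (bergmanFun_differentiableOn f).mono hsub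
    have hm : MemLp (bergmanFun f) 2 (volume.restrict (annulus ε : Set ℂ)) :=
      (memLp_bergmanFun f).mono_measure (Measure.restrict_mono hsub le_rfl)
    have hz := memLp_zpow_annulus hε.1.le (n := n) (Or.inl hε.1)
    have hcε : laurentCoeff ε (bergmanFun f) n = c :=
      circleAverage_mul_zpow le_rfl (bergmanFun_differentiableOn f) n
        (s := (ε + 1) / 2) ⟨by linarith [hε.1], by linarith [hε.2]⟩
    have h1 := inner_zpow_toLp hε.1.le hε.2 hz hd hm
    have h2 := inner_zpow_toLp hε.1.le hε.2 hz (differentiableOn_zpow_annulus hε.1.le n) hz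
    rw [laurentCoeff_zpow hε.1.le, if_pos rfl, mul_one, inner_self_eq_norm_sq_to_K] at h2
    rw [hcε] at h1
    have h2' : ‖hz.toLp _‖ ^ 2 = monomialNormSq ε n := Complex.ofReal_injective (by push_cast; exact h2)
    have hpos := monomialNormSq_pos hε.1.le hε.2 (n := n) (Or.inl hε.1)
    have h3 := norm_inner_le_norm (𝕜 := ℂ) (hz.toLp _) (hm.toLp _)
    rw [h1, norm_mul, Complex.norm_real, Real.norm_of_nonneg hpos.le] at h3
    have h4 : ‖hm.toLp _‖ ≤ ‖f‖ := by
      have h5 : ‖f‖ = ‖(memLp_bergmanFun f).toLp _‖ := by rw [toLp_bergmanFun]; rfl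
      rw [h5, Lp.norm_toLp, Lp.norm_toLp]
      exact ENNReal.toReal_mono (memLp_bergmanFun f).2.ne
        (eLpNorm_mono_measure _ (Measure.restrict_mono hsub le_rfl))
    have h5 : (monomialNormSq ε n * ‖c‖) ^ 2 ≤ monomialNormSq ε n * ‖f‖ ^ 2 := by
      rw [← h2', ← mul_pow, h2']
      exact pow_le_pow_left₀ (by positivity) (h3.trans (by gcongr)) 2
    have h6 : monomialNormSq ε n * ‖c‖ ^ 2 ≤ ‖f‖ ^ 2 := by
      rw [mul_pow, sq (monomialNormSq ε n), mul_assoc] at h5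
      exact le_of_mul_le_mul_left h5 hpos
    refine le_trans ?_ h6
    gcongr
    rw [← monomialNormSq_neg_one hε.1, monomialNormSq, monomialNormSq]
    gcongr 2 * Real.pi * ?_
    refine intervalIntegral.integral_mono_on hε.2.le
      (intervalIntegrable_zpow_of hε.2 (Or.inl hε.1))
      (intervalIntegrable_zpow_of hε.2 (Or.inl hε.1)) fun s hs => ?_
    exact zpow_le_zpow_right_of_le_one₀ (hε.1.trans_le hs.1) hs.2 (by omega)
  by_contra hc0
  have hpos : 0 < 2 * Real.pi * ‖c‖ ^ 2 := by positivity
  obtain ⟨ε, hε, hlog⟩ : ∃ ε ∈ Ioo (0 : ℝ) 1, ‖f‖ ^ 2 / (2 * Real.pi * ‖c‖ ^ 2) < Real.log ε⁻¹ := by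
    set M := ‖f‖ ^ 2 / (2 * Real.pi * ‖c‖ ^ 2)
    have hM : 0 ≤ M := by positivity
    refine ⟨Real.exp (-(M + 1)), ⟨Real.exp_pos _, by rw [Real.exp_lt_one_iff]; linarith⟩, ?_⟩
    rw [Real.log_inv, Real.log_exp]
    linarith
  have := hle ε hε
  rw [div_lt_iff₀ hpos] at hlog
  linarith

/-- The normalized monomials form an orthonormal basis of the Bergman space of an annulus, in which
multiplication by a radial symbol followed by the projection is diagonal. -/
theorem exists_hilbertBasis_monomials {r : ℝ} (hr : 0 ≤ r) (hr1 : r < 1) {ι : Type*} (ν : ι → ℤ)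
    (hinj : Function.Injective ν) (hν : ∀ n, (∃ i, ν i = n) ↔ (0 < r ∨ 0 ≤ n)) :
    ∃ e : HilbertBasis ι ℂ (bergmanSpace (annulus r)),
      (∀ i, ∀ z ∈ annulus r,
        bergmanFun (e i) z = ((Real.sqrt (monomialNormSq r (ν i)))⁻¹ : ℝ) * z ^ ν i) ∧
      ∀ (h : ℝ → ℝ), ContinuousOn h (Ioo r 1) → ∀ (f : bergmanSpace (annulus r))
        (hf : MemLp (fun w => h ‖w‖ * bergmanFun f w) 2 (volume.restrict (annulus r : Set ℂ))) i,
        inner ℂ (e i) (bergmanProj (annulus r) (hf.toLp _)) =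
          ((2 * Real.pi * ∫ s in r..1, s ^ (2 * ν i + 1) * h s) / monomialNormSq r (ν i) : ℝ) *
            inner ℂ (e i) f := by
  -- `ν` enumerates the square-integrable exponents, so one statement covers the index set `ℤ` for
  -- `r > 0` and `ℕ` for `r = 0`.
  have hmem : ∀ i, 0 < r ∨ 0 ≤ ν i := fun i => (hν _).1 ⟨i, rfl⟩
  set m : ι → bergmanSpace (annulus r) := fun i =>
    bergmanMk (differentiableOn_zpow_annulus hr (ν i)) (memLp_zpow_annulus hr (hmem i)) with hm
  have hpos : ∀ i, 0 < monomialNormSq r (ν i) := fun i => monomialNormSq_pos hr hr1 (hmem i)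
  have hmf : ∀ i (f : bergmanSpace (annulus r)), inner ℂ (m i) f =
      monomialNormSq r (ν i) * laurentCoeff r (bergmanFun f) (ν i) := fun i f => by
    rw [Submodule.coe_inner, ← toLp_bergmanFun f]
    exact inner_zpow_toLp hr hr1 (memLp_zpow_annulus hr (hmem i)) (bergmanFun_differentiableOn f)
      (memLp_bergmanFun f)
  have hmm : ∀ i j, inner ℂ (m i) (m j) =
      if ν j = ν i then (monomialNormSq r (ν i) : ℂ) else 0 := fun i j => by
    rw [Submodule.coe_inner]
    refine (inner_zpow_toLp hr hr1 (memLp_zpow_annulus hr (hmem i))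
      (differentiableOn_zpow_annulus hr (ν j)) (memLp_zpow_annulus hr (hmem j))).trans ?_
    rw [laurentCoeff_zpow hr, mul_ite, mul_one, mul_zero]
  set v : ι → bergmanSpace (annulus r) := fun i =>
    (((Real.sqrt (monomialNormSq r (ν i)))⁻¹ : ℝ) : ℂ) • m i with hv
  have hort : Orthonormal ℂ v := by
    classical
    rw [orthonormal_iff_ite]
    intro i j
    rw [hv]
    simp only
    rw [inner_smul_left (m i), inner_smul_right (m i), hmm, Complex.conj_ofReal]
    by_cases h : i = j
    · subst h
      rw [if_pos rfl, if_pos rfl]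
      have h1 := Real.mul_self_sqrt (hpos i).le
      have h2 : Real.sqrt (monomialNormSq r (ν i)) ≠ 0 := (Real.sqrt_pos.2 (hpos i)).ne'
      norm_cast
      field_simp
      rw [sq, h1]
    · rw [if_neg fun h' => h (hinj h').symm, if_neg h, mul_zero, mul_zero]
  have hc0 : ∀ i, (((Real.sqrt (monomialNormSq r (ν i)))⁻¹ : ℝ) : ℂ) ≠ 0 := fun i =>
    Complex.ofReal_ne_zero.2 (inv_ne_zero (Real.sqrt_pos.2 (hpos i)).ne')
  have hbot : (Submodule.span ℂ (range v))ᗮ = ⊥ := by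
    rw [Submodule.eq_bot_iff]
    intro f hf
    have hvf : ∀ i, inner ℂ (m i) f = 0 := fun i => by
      have := (Submodule.mem_orthogonal _ _).1 hf (v i) (Submodule.subset_span ⟨i, rfl⟩)
      rw [hv] at this
      simp only at this
      rw [inner_smul_left (m i), mul_eq_zero] at this
      exact this.resolve_left ((map_ne_zero _).2 (hc0 i))
    -- Completeness: orthogonality kills the coefficients at indexed exponents, and for `r = 0` the
    -- negative ones vanish by square-integrability alone.
    have hl : ∀ n, laurentCoeff r (bergmanFun f) n = 0 := fun n => by
      by_cases hn : 0 < r ∨ 0 ≤ n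
      · obtain ⟨i, rfl⟩ := (hν n).2 hn
        have := hvf i
        rw [hmf, mul_eq_zero] at this
        exact this.resolve_left (Complex.ofReal_ne_zero.2 (hpos i).ne')
      · push Not at hn
        obtain rfl : r = 0 := le_antisymm hn.1 hr
        exact laurentCoeff_eq_zero_of_neg f hn.2
    refine Subtype.ext (Lp.ext ?_)
    filter_upwards [bergmanFun_ae_eq f, ae_restrict_mem (annulus r).isOpen.measurableSet,
      Lp.coeFn_zero ℂ 2 (volume.restrict (annulus r : Set ℂ))] with z h1 h2 h3
    rw [h1, eq_zero_of_laurentCoeff_eq_zero hr (bergmanFun_differentiableOn f) hl h2]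
    exact h3.symm
  refine ⟨HilbertBasis.mkOfOrthogonalEqBot hort hbot, fun i z hz => ?_, fun h hh f hf i => ?_⟩
  · rw [HilbertBasis.coe_mkOfOrthogonalEqBot, hv]
    simp only
    rw [bergmanFun_smul, bergmanFun_bergmanMk _ _ hz]
  · rw [HilbertBasis.coe_mkOfOrthogonalEqBot, hv]
    simp only
    rw [inner_smul_left (m i), inner_smul_left (m i), inner_bergmanProj, hmf]
    have := inner_zpow_toLp_radial hr hr1 (memLp_zpow_annulus hr (hmem i))
      (bergmanFun_differentiableOn f) hh hf
    rw [show ((m i : bergmanSpace (annulus r)) : Lp ℂ 2 (volume.restrict (annulus r : Set ℂ))) =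
      (memLp_zpow_annulus hr (hmem i)).toLp _ from rfl, this]
    have h1 : (monomialNormSq r (ν i) : ℂ) ≠ 0 := Complex.ofReal_ne_zero.2 (hpos i).ne'
    push_cast
    field_simp

/-! ### Diagonal operators -/

theorem HilbertBasis.eq_of_inner_eq {ι E : Type*} [NormedAddCommGroup E] [InnerProductSpace ℂ E]
    (e : HilbertBasis ι ℂ E) {x y : E} (h : ∀ i, inner ℂ (e i) x = inner ℂ (e i) y) : x = y := by
  refine e.repr.injective (lp.ext (funext fun i => ?_))
  rw [e.repr_apply_apply, e.repr_apply_apply, h]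

theorem HilbertBasis.hasSum_norm_inner_sq {ι E : Type*} [NormedAddCommGroup E]
    [InnerProductSpace ℂ E] (e : HilbertBasis ι ℂ E) (x : E) :
    HasSum (fun i => ‖(inner ℂ (e i) x : ℂ)‖ ^ 2) (‖x‖ ^ 2) := by
  have h := e.hasSum_inner_mul_inner x x
  rw [inner_self_eq_norm_sq_to_K] at h
  refine Complex.hasSum_ofReal.1 ?_
  push_cast
  convert! h using 2 with i
  rw [← inner_conj_symm x (e i), Complex.conj_mul']

/-- A bounded operator that is diagonal in an orthonormal basis, with eigenvalues tending to zero,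
is compact. -/
theorem isCompactOperator_of_diagonal {E : Type*} [NormedAddCommGroup E] [InnerProductSpace ℂ E]
    [CompleteSpace E] (e : HilbertBasis ℕ ℂ E) (T : E →L[ℂ] E) (c : ℕ → ℂ)
    (hT : ∀ f i, inner ℂ (e i) (T f) = c i * inner ℂ (e i) f) (hc : Tendsto c atTop (𝓝 0)) :
    IsCompactOperator T := by
  -- Finite-rank truncations of `T`, which will converge to it in operator norm.
  set S : ℕ → E →L[ℂ] E := fun N =>
    ∑ i ∈ Finset.range N, (ContinuousLinearMap.toSpanSingleton ℂ (c i • e i)).comp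
      (innerSL ℂ (e i)) with hS
  have hcomp : ∀ N, IsCompactOperator (S N) := fun N => by
    rw [hS]
    refine Submodule.sum_mem (compactOperator (RingHom.id ℂ) E E) fun i _ => ?_
    exact (isCompactOperator_of_locallyCompactSpace_rng
      (ContinuousLinearMap.toSpanSingleton ℂ (c i • e i))).comp_clm (innerSL ℂ (e i))
  have hin : ∀ N f j, inner ℂ (e j) (S N f) =
      if j < N then c j * inner ℂ (e j) f else 0 := fun N f j => by
    have h1 : S N f = ∑ i ∈ Finset.range N, ((inner ℂ (e i) f : ℂ) * c i) • e i := by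
      simp [hS, smul_smul]
    rw [h1, inner_sum]
    simp only [inner_smul_right, orthonormal_iff_ite.1 e.orthonormal, mul_ite, mul_one, mul_zero,
      Finset.sum_ite_eq, Finset.mem_range]
    simp only [mul_comm]
  refine isCompactOperator_of_tendsto (l := atTop) (F := S) ?_ (Eventually.of_forall hcomp)
  rw [Metric.tendsto_atTop]
  intro ε hε
  obtain ⟨N, hN⟩ := Metric.tendsto_atTop.1 hc (ε / 2) (by positivity)
  refine ⟨N, fun M hM => ?_⟩
  rw [dist_eq_norm]
  refine lt_of_le_of_lt (ContinuousLinearMap.opNorm_le_bound _ (by positivity) fun f => ?_)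
    (half_lt_self hε)
  -- By Parseval, `‖(S M - T) f‖²` is the sum of `|c i|² |⟨e i, f⟩|²` over `i ≥ M`, hence at most
  -- `(ε/2)² ‖f‖²`.
  refine le_of_sq_le_sq ?_ (by positivity)
  rw [mul_pow]
  refine hasSum_le (fun i => ?_) (e.hasSum_norm_inner_sq _)
    ((e.hasSum_norm_inner_sq f).mul_left _)
  rw [← mul_pow]
  refine pow_le_pow_left₀ (norm_nonneg _) ?_ 2
  rw [_root_.sub_apply, inner_sub_right, hin, hT]
  split_ifs with h
  · rw [sub_self, norm_zero]
    positivity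
  · rw [zero_sub, norm_neg, norm_mul]
    gcongr
    have := hN i (by omega)
    rw [dist_zero_right] at this
    exact this.le

/-! ### Toeplitz operators, kernels and Berezin transforms on general open sets -/

/-- Boundedness is automatic by the closed graph theorem: an `L²` limit is an a.e. limit along a
subsequence, and continuity of point evaluations identifies it as `φ` times the limit function. -/
theorem isToeplitzOperator_toeplitz {Ω : Opens ℂ} {φ : ℂ → ℂ}
    (h : ∀ f : bergmanSpace Ω,
      MemLp (fun w => φ w * bergmanFun f w) 2 (volume.restrict (Ω : Set ℂ))) :
    IsToeplitzOperator Ω φ (toeplitz Ω φ) := by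
  let M : bergmanSpace Ω →ₗ[ℂ] Lp ℂ 2 (volume.restrict (Ω : Set ℂ)) :=
    { toFun := fun f => (h f).toLp _
      map_add' := fun f g => by
        rw [← MemLp.toLp_add]
        refine MemLp.toLp_congr _ _ (Eventually.of_forall fun w => ?_)
        simp only [Pi.add_apply]
        rw [bergmanFun_add, mul_add]
      map_smul' := fun c f => by
        rw [RingHom.id_apply, ← MemLp.toLp_const_smul]
        refine MemLp.toLp_congr _ _ (Eventually.of_forall fun w => ?_)
        simp only [Pi.smul_apply, smul_eq_mul]
        rw [bergmanFun_smul]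
        ring }
  have hMc : Continuous M := by
    refine M.continuous_of_seq_closed_graph fun u x y hu hMu => ?_
    obtain ⟨ns, hns, hae⟩ := (tendstoInMeasure_of_tendsto_Lp hMu).exists_seq_tendsto_ae
    have hall : ∀ᵐ z ∂(volume.restrict (Ω : Set ℂ)),
        ∀ n, M (u n) z = φ z * bergmanFun (u n) z :=
      ae_all_iff.2 fun n => (h (u n)).coeFn_toLp
    refine Lp.ext ?_
    filter_upwards [hae, hall, (h x).coeFn_toLp] with z h1 h2 h3
    refine (tendsto_nhds_unique h1 ?_).trans h3.symm
    simp only [Function.comp_apply, h2]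
    refine Tendsto.const_mul _ ?_
    exact (((bergmanEval Ω z).continuous.tendsto x).comp hu).comp hns.tendsto_atTop
  have hex : ∃ T, IsToeplitzOperator Ω φ T :=
    ⟨(bergmanProj Ω).comp ⟨M, hMc⟩, fun f => ⟨h f, rfl⟩⟩
  rw [toeplitz, dif_pos hex]
  exact hex.choose_spec

theorem bergmanKernel_self (Ω : Opens ℂ) (z : ℂ) :
    bergmanKernel Ω z z = ((‖bergmanKernelFun Ω z‖ ^ 2 : ℝ) : ℂ) := by
  rw [bergmanKernel, ← inner_bergmanKernelFun,
    inner_self_eq_norm_sq_to_K (𝕜 := ℂ) (bergmanKernelFun Ω z)]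
  push_cast
  rfl

theorem normalizedBergmanKernel_eq (Ω : Opens ℂ) (z : ℂ) :
    normalizedBergmanKernel Ω z = ((‖bergmanKernelFun Ω z‖ : ℂ))⁻¹ • bergmanKernelFun Ω z := by
  rw [normalizedBergmanKernel, bergmanKernel_self, Complex.ofReal_re,
    Real.sqrt_sq (norm_nonneg _)]

/-- Only an inequality: where `K_z = 0`, in particular off `Ω`, the convention `0⁻¹ = 0` makes the
normalized kernel zero. -/
theorem norm_normalizedBergmanKernel_le (Ω : Opens ℂ) (z : ℂ) :
    ‖normalizedBergmanKernel Ω z‖ ≤ 1 := by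
  rw [normalizedBergmanKernel_eq, norm_smul, norm_inv, Complex.norm_real, norm_norm]
  exact inv_mul_le_one

theorem norm_berezin_le (Ω : Opens ℂ) (T : bergmanSpace Ω →L[ℂ] bergmanSpace Ω) (z : ℂ) :
    ‖berezin Ω T z‖ ≤ ‖T‖ := by
  have h := norm_normalizedBergmanKernel_le Ω z
  calc ‖berezin Ω T z‖ ≤ ‖normalizedBergmanKernel Ω z‖ * ‖T (normalizedBergmanKernel Ω z)‖ :=
        norm_inner_le_norm (𝕜 := ℂ) (normalizedBergmanKernel Ω z) _
    _ ≤ 1 * (‖T‖ * 1) := by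
        gcongr
        exact (T.le_opNorm _).trans (by gcongr)
    _ = ‖T‖ := by ring

/-- The Schwarz lemma, applied to all `f` at once with the uniform bound on point evaluations, makes
`z ↦ bergmanEval Ω z` locally Lipschitz in operator norm. This yields measurability of Berezin
transforms. -/
theorem continuousOn_bergmanKernelFun (Ω : Opens ℂ) :
    ContinuousOn (bergmanKernelFun Ω) Ω := by
  have hE : ContinuousOn (bergmanEval Ω) Ω := by
    intro z hz
    refine ContinuousAt.continuousWithinAt ?_
    obtain ⟨ε, hε, hsub⟩ := Metric.isOpen_iff.1 Ω.isOpen z hz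
    obtain ⟨C, hC⟩ := bergmanFun_bound (ε / 2) (by positivity)
    have hb : ∀ w ∈ Metric.ball z (ε / 2), ∀ f : bergmanSpace Ω,
        ‖bergmanFun f w‖ ≤ |C| * ‖f‖ := fun w hw f =>
      (hC Ω w ((Metric.ball_subset_ball' (by linarith [Metric.mem_ball.1 hw])).trans hsub) f).trans
        (by gcongr; exact le_abs_self C)
    have hlip : ∀ w ∈ Metric.ball z (ε / 2),
        ‖bergmanEval Ω w - bergmanEval Ω z‖ ≤ 4 * |C| / ε * dist w z := by
      intro w hw
      refine ContinuousLinearMap.opNorm_le_bound _ (by positivity) fun f => ?_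
      have hd := Complex.dist_le_div_mul_dist_of_mapsTo_ball (f := bergmanFun f) (c := z)
        (R₁ := ε / 2) (R₂ := 2 * |C| * ‖f‖) ((bergmanFun_differentiableOn f).mono
          ((Metric.ball_subset_ball (by linarith)).trans hsub)) (fun x hx => by
            rw [Metric.mem_closedBall, dist_eq_norm]
            refine (norm_sub_le _ _).trans ?_
            linarith [hb x hx f, hb z (Metric.mem_ball_self (by positivity)) f]) hw
      rw [dist_eq_norm (bergmanFun f w)] at hd
      refine hd.trans_eq ?_
      field_simp
      ring
    rw [ContinuousAt]
    refine (tendsto_iff_norm_sub_tendsto_zero (E := bergmanSpace Ω →L[ℂ] ℂ)).2 ?_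
    have h0 : Tendsto (fun w => 4 * |C| / ε * dist w z) (𝓝 z) (𝓝 0) := by
      have := (tendsto_iff_dist_tendsto_zero.1 (tendsto_id (α := ℂ) (x := 𝓝 z))).const_mul
        (4 * |C| / ε)
      rwa [mul_zero] at this
    refine squeeze_zero' (Eventually.of_forall fun w =>
      norm_nonneg (bergmanEval Ω w - bergmanEval Ω z)) ?_ h0
    filter_upwards [Metric.ball_mem_nhds z (half_pos hε)] with w hw using hlip w hw
  exact (InnerProductSpace.toDual ℂ (bergmanSpace Ω)).symm.continuous.comp_continuousOn hE

theorem aestronglyMeasurable_berezin (Ω : Opens ℂ) (T : bergmanSpace Ω →L[ℂ] bergmanSpace Ω) :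
    AEStronglyMeasurable (berezin Ω T) (volume.restrict (Ω : Set ℂ)) := by
  have hK := (continuousOn_bergmanKernelFun Ω).aestronglyMeasurable Ω.isOpen.measurableSet
    (μ := volume)
  have hK' : AEStronglyMeasurable (fun z => inner ℂ (bergmanKernelFun Ω z)
      (T (bergmanKernelFun Ω z))) (volume.restrict (Ω : Set ℂ)) :=
    hK.inner (T.continuous.comp_aestronglyMeasurable hK)
  have hn : AEStronglyMeasurable (fun z => (((‖bergmanKernelFun Ω z‖ ^ 2)⁻¹ : ℝ) : ℂ))
      (volume.restrict (Ω : Set ℂ)) :=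
    Complex.continuous_ofReal.comp_aestronglyMeasurable
      (hK.norm.aemeasurable.pow_const 2).inv.aestronglyMeasurable
  refine (hn.mul hK').congr (Eventually.of_forall fun z => ?_)
  simp only [Pi.mul_apply, berezin]
  rw [normalizedBergmanKernel_eq, map_smul, inner_smul_left (bergmanKernelFun Ω z),
    inner_smul_right (bergmanKernelFun Ω z), map_inv₀, Complex.conj_ofReal]
  push_cast
  ring

theorem memLp_zeroExtension_berezin {Ω U : Opens ℂ} (hU : (Ω : Set ℂ) ⊆ U)
    [IsFiniteMeasure (volume.restrict (U : Set ℂ))]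
    (T : bergmanSpace Ω →L[ℂ] bergmanSpace Ω) (p : ℝ≥0∞) :
    MemLp (zeroExtension Ω (berezin Ω T)) p (volume.restrict (U : Set ℂ)) := by
  refine MemLp.of_bound ?_ ‖T‖ (Eventually.of_forall fun z => ?_)
  · rw [zeroExtension, aestronglyMeasurable_indicator_iff Ω.isOpen.measurableSet,
      Measure.restrict_restrict_of_subset hU]
    exact aestronglyMeasurable_berezin Ω T
  · rw [zeroExtension]
    exact (norm_indicator_le_norm_self _ _).trans (norm_berezin_le Ω T z)

/-! ### Square-integrability of `log |z| · f` and bounds on the monomial terms -/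

theorem puncturedDisc_eq_annulus : puncturedDisc = annulus 0 := by
  refine Opens.ext (Set.ext fun z => ?_)
  change z ∈ Metric.ball (0 : ℂ) 1 \ {0} ↔ 0 < ‖z‖ ∧ ‖z‖ < 1
  rw [Set.mem_sdiff, mem_ball_zero_iff, mem_singleton_iff, norm_pos_iff, and_comm]

theorem memLp_log_norm_annulus_zero :
    MemLp (fun w : ℂ => Real.log ‖w‖) 2 (volume.restrict (annulus 0 : Set ℂ)) := by
  have hm : Measurable fun w : ℂ => Real.log ‖w‖ := Real.measurable_log.comp measurable_norm
  have hsub : (annulus 0 : Set ℂ) ⊆ Metric.ball 0 1 := fun z hz => mem_ball_zero_iff.2 hz.2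
  refine MemLp.mono_measure (Measure.restrict_mono hsub le_rfl)
    ((memLp_two_iff_integrable_sq hm.aestronglyMeasurable).2 ?_)
  refine (integrableOn_fun_norm_addHaar (volume : Measure ℂ)
    (f := fun y : ℝ => Real.log y ^ 2) (r := 1)).2 ?_
  rw [Complex.finrank_real_complex]
  refine Measure.integrableOn_of_bounded (M := 4) measure_Ioo_lt_top.ne
    (by fun_prop) ?_
  -- The radial integrand is `s log² s = (√s log s)²`, and `|√s log s| < 2`; hence the bound `4`.
  filter_upwards [ae_restrict_mem measurableSet_Ioo] with s hs
  have h := Real.abs_log_mul_self_rpow_lt s (1 / 2) hs.1 hs.2.le (by norm_num)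
  rw [← Real.sqrt_eq_rpow] at h
  have h1 : s ^ (2 - 1) • Real.log s ^ 2 = (Real.log s * √s) ^ 2 := by
    rw [mul_pow, Real.sq_sqrt hs.1.le, smul_eq_mul]
    ring
  rw [h1, Real.norm_of_nonneg (sq_nonneg _), ← sq_abs]
  have h2 := abs_nonneg (Real.log s * √s)
  rw [one_div_one_div] at h
  nlinarith

/-- Parseval for `K_z`: the expansion `K(z,z) = ∑ |e_i(z)|²`. -/
theorem hasSum_norm_bergmanFun_sq {ι : Type*} {Ω : Opens ℂ}
    (e : HilbertBasis ι ℂ (bergmanSpace Ω)) (z : ℂ) :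
    HasSum (fun i => ‖bergmanFun (e i) z‖ ^ 2) (‖bergmanKernelFun Ω z‖ ^ 2) := by
  convert! e.hasSum_norm_inner_sq (bergmanKernelFun Ω z) using 3 with i
  rw [← inner_bergmanKernelFun]
  exact norm_inner_symm (𝕜 := ℂ) (bergmanKernelFun Ω z) (e i)

theorem norm_normalized_zpow_sq {r : ℝ} (hr : 0 ≤ r) (hr1 : r < 1) {n : ℤ} (hn : 0 < r ∨ 0 ≤ n)
    (z : ℂ) : ‖(((Real.sqrt (monomialNormSq r n))⁻¹ : ℝ) : ℂ) * z ^ n‖ ^ 2 =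
      ‖z‖ ^ (2 * n) / monomialNormSq r n := by
  rw [norm_mul, mul_pow, Complex.norm_real, Real.norm_eq_abs, sq_abs, inv_pow,
    Real.sq_sqrt (monomialNormSq_pos hr hr1 hn).le, norm_zpow, ← zpow_natCast, ← zpow_mul,
    mul_comm n]
  rw [div_eq_inv_mul]
  rfl

/-- `1 - r^(2n+2) ≥ 3/4` and `3π/4 > 1` give `‖wⁿ‖² ≥ 1/(n+1)`, while `t^(2n) ≤ 4⁻ⁿ`. The bound is
summable and uniform in `r` and `t`. -/
theorem zpow_div_monomialNormSq_natCast_le {r t : ℝ} (hr : 0 ≤ r) (hr2 : r ≤ 1 / 2)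
    (ht : 0 ≤ t) (ht2 : t ≤ 1 / 2) (n : ℕ) :
    t ^ (2 * (n : ℤ)) / monomialNormSq r n ≤ ((n : ℝ) + 1) * (1 / 4) ^ n := by
  have hpos := monomialNormSq_pos hr (by linarith) (n := n) (Or.inr (by positivity))
  rw [div_le_iff₀ hpos, monomialNormSq_of_ne (Or.inr (by positivity))]
  have h1 : t ^ (2 * (n : ℤ)) ≤ (1 / 4) ^ n := by
    rw [show (2 * (n : ℤ)) = ((2 * n : ℕ) : ℤ) by push_cast; ring, zpow_natCast, pow_mul]
    exact pow_le_pow_left₀ (by positivity) (by nlinarith) n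
  have h2 : r ^ (2 * (n : ℤ) + 2) ≤ 1 / 4 := by
    rw [show (2 * (n : ℤ) + 2) = ((2 * (n + 1) : ℕ) : ℤ) by push_cast; ring, zpow_natCast, pow_mul]
    refine (pow_le_pow_left₀ (by positivity) (show r ^ 2 ≤ 1 / 4 by nlinarith) (n + 1)).trans ?_
    rw [pow_succ]
    have : (1 / 4 : ℝ) ^ n ≤ 1 := pow_le_one₀ (by norm_num) (by norm_num)
    linarith
  have h3 : 1 ≤ Real.pi * (1 - r ^ (2 * (n : ℤ) + 2)) := by nlinarith [Real.pi_gt_three]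
  refine h1.trans ?_
  push_cast
  rw [show ((n : ℝ) + 1) * (1 / 4) ^ n * (Real.pi * (1 - r ^ (2 * (n : ℤ) + 2)) / (n + 1)) =
    (1 / 4) ^ n * (Real.pi * (1 - r ^ (2 * (n : ℤ) + 2))) by field_simp]
  exact le_mul_of_one_le_right (by positivity) h3

/-- The exponent is `-(n+2)`, so `-1` is excluded. With `R = r^(2(n+1))` the norm squared is `π(R⁻¹
- 1)/(n+1) ≥ R⁻¹/(n+1)`, and `r ≤ t²` gives `R ≤ t^(4(n+1)) = t^(2n) t^(2(n+2)) ≤ 4⁻ⁿ t^(2(n+2))`.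
-/
theorem zpow_div_monomialNormSq_neg_le {r t : ℝ} (hr : 0 < r) (ht2 : t ≤ 1 / 2) (ht0 : 0 < t)
    (hrt : r ≤ t ^ 2) (n : ℕ) :
    t ^ (2 * (-((n + 1 : ℕ) + 1 : ℤ))) / monomialNormSq r (-((n + 1 : ℕ) + 1 : ℤ)) ≤
      ((n : ℝ) + 1) * (1 / 4) ^ n := by
  have hr4 : r ≤ 1 / 4 := hrt.trans (by nlinarith)
  have hpos := monomialNormSq_pos hr.le (by linarith) (n := -((n + 1 : ℕ) + 1 : ℤ)) (Or.inl hr)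
  rw [div_le_iff₀ hpos, monomialNormSq_of_ne (Or.inl ⟨hr, by omega⟩)]
  rw [show 2 * (-((n + 1 : ℕ) + 1 : ℤ)) + 2 = -((2 * (n + 1) : ℕ) : ℤ) by push_cast; ring,
    show 2 * (-((n + 1 : ℕ) + 1 : ℤ)) = -((2 * (n + 2) : ℕ) : ℤ) by push_cast; ring,
    zpow_neg, zpow_neg, zpow_natCast, zpow_natCast, pow_mul, pow_mul]
  have e1 : ((n : ℝ) + 1) * (1 / 4) ^ n * (Real.pi * (1 - ((r ^ 2) ^ (n + 1))⁻¹) /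
      (((-((n + 1 : ℕ) + 1 : ℤ) : ℤ) : ℝ) + 1)) =
      (1 / 4) ^ n * (Real.pi * (((r ^ 2) ^ (n + 1))⁻¹ - 1)) := by
    have : (((-((n + 1 : ℕ) + 1 : ℤ) : ℤ) : ℝ) + 1) = -((n : ℝ) + 1) := by push_cast; ring
    rw [this]
    have h0 : (n : ℝ) + 1 ≠ 0 := by positivity
    field_simp
    ring
  rw [e1]
  set R := (r ^ 2) ^ (n + 1) with hR
  have hRpos : 0 < R := by positivity
  have hR4 : R ≤ 1 / 4 := by
    rw [hR, pow_succ]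
    have h1 : (r ^ 2) ^ n ≤ 1 := pow_le_one₀ (by positivity) (by nlinarith)
    nlinarith [sq_nonneg r]
  have h2 : R⁻¹ ≤ Real.pi * (R⁻¹ - 1) := by
    have h4 : 4 ≤ R⁻¹ := by
      rw [le_inv_comm₀ (by norm_num) hRpos]
      linarith
    nlinarith [Real.pi_gt_three]
  have h3 : R ≤ (1 / 4) ^ n * (t ^ 2) ^ (n + 2) := by
    calc R ≤ ((t ^ 2) ^ 2) ^ (n + 1) := by
          rw [hR]; gcongr
      _ = (t ^ 2) ^ n * (t ^ 2) ^ (n + 2) := by ring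
      _ ≤ _ := by
          gcongr
          nlinarith
  calc ((t ^ 2) ^ (n + 2))⁻¹ ≤ (1 / 4) ^ n * R⁻¹ := by
        rw [← div_eq_mul_inv, le_div_iff₀ hRpos, inv_mul_le_iff₀ (by positivity)]
        linarith
    _ ≤ _ := by gcongr

theorem summable_succ_mul_geometric : Summable fun n : ℕ => ((n : ℝ) + 1) * (1 / 4) ^ n := by
  have h1 := (hasSum_coe_mul_geometric_of_norm_lt_one (𝕜 := ℝ) (r := 1 / 4) (by norm_num)).summable
  have h2 := summable_geometric_of_lt_one (r := (1 / 4 : ℝ)) (by norm_num) (by norm_num)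
  simpa only [add_mul, one_mul] using h1.add h2

theorem natCast_index_iff (n : ℤ) : (∃ i : ℕ, (i : ℤ) = n) ↔ ((0 : ℝ) < 0 ∨ 0 ≤ n) := by
  simp only [lt_self_iff_false, false_or]
  exact ⟨fun ⟨i, hi⟩ => hi ▸ Int.natCast_nonneg i, fun h => ⟨n.toNat, Int.toNat_of_nonneg h⟩⟩

/-- A function in `A²(𝔻*)` is bounded near the puncture. -/
theorem exists_bergmanFun_bound_near_puncture (f : bergmanSpace (annulus 0)) :
    ∃ M, 0 ≤ M ∧ ∀ z ∈ annulus 0, ‖z‖ ≤ 1 / 2 → ‖bergmanFun f z‖ ≤ M := by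
  obtain ⟨e, he, -⟩ := exists_hilbertBasis_monomials le_rfl one_pos (fun n : ℕ => (n : ℤ))
    Nat.cast_injective natCast_index_iff
  refine ⟨Real.sqrt (∑' n : ℕ, ((n : ℝ) + 1) * (1 / 4) ^ n) * ‖f‖, by positivity,
    fun z hz hz2 => ?_⟩
  -- As `f(z) = ⟨K_z, f⟩`, it is enough to bound `K(z,z)`, a sum over `n ≥ 0` only, uniformly for
  -- `|z| ≤ 1/2`.
  rw [← inner_bergmanKernelFun]
  refine (norm_inner_le_norm (𝕜 := ℂ) (bergmanKernelFun (annulus 0) z) f).trans ?_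
  gcongr
  refine Real.le_sqrt_of_sq_le ?_
  refine hasSum_le (fun n => ?_) (hasSum_norm_bergmanFun_sq e z)
    summable_succ_mul_geometric.hasSum
  rw [he n z hz, norm_normalized_zpow_sq le_rfl one_pos (Or.inr (by positivity))]
  exact zpow_div_monomialNormSq_natCast_le le_rfl (by norm_num) (norm_nonneg z) hz2 n

/-- For `r > 0` the symbol is bounded. For `r = 0`, `f` is bounded by `M` on `|w| ≤ 1/2` and the
symbol by `log 2` beyond, so `log 2 · |f| + M |log |w||` dominates the product. -/
theorem isToeplitzOperator_toeplitz_logSymbol {r : ℝ} (hr : 0 ≤ r) :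
    IsToeplitzOperator (annulus r) logSymbol (toeplitz (annulus r) logSymbol) := by
  refine isToeplitzOperator_toeplitz fun f => ?_
  have hlog : Measurable logSymbol :=
    Complex.measurable_ofReal.comp (Real.measurable_log.comp measurable_norm)
  have hm : AEStronglyMeasurable (fun w => logSymbol w * bergmanFun f w)
      (volume.restrict (annulus r : Set ℂ)) :=
    hlog.aestronglyMeasurable.mul (memLp_bergmanFun f).1
  have habs : ∀ {c : ℝ}, 0 < c → ∀ {w : ℂ}, c ≤ ‖w‖ → ‖w‖ < 1 → ‖logSymbol w‖ ≤ -Real.log c := by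
    intro c hc w hcw hw
    have h1 : ‖logSymbol w‖ = |Real.log ‖w‖| := by
      rw [logSymbol, Complex.norm_real, Real.norm_eq_abs]
    rw [h1, abs_of_nonpos (Real.log_nonpos (norm_nonneg _) hw.le)]
    exact neg_le_neg (Real.log_le_log hc hcw)
  rcases hr.eq_or_lt with rfl | hr0
  · obtain ⟨M, hM0, hM⟩ := exists_bergmanFun_bound_near_puncture f
    have h1 := ((memLp_bergmanFun f).norm.const_mul (-Real.log (1 / 2))).add
      (memLp_log_norm_annulus_zero.norm.const_mul M)
    refine h1.of_le hm ?_
    filter_upwards [ae_restrict_mem (annulus 0).isOpen.measurableSet] with w hw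
    have hl2 : 0 ≤ -Real.log (1 / 2) :=
      neg_nonneg.2 (Real.log_nonpos (by norm_num) (by norm_num))
    have hln : ‖logSymbol w‖ = ‖Real.log ‖w‖‖ := by rw [logSymbol, Complex.norm_real]
    have e1 : ‖((fun w => -Real.log (1 / 2) * ‖bergmanFun f w‖) +
        fun w : ℂ => M * ‖Real.log ‖w‖‖) w‖ =
        -Real.log (1 / 2) * ‖bergmanFun f w‖ + M * ‖Real.log ‖w‖‖ := by
      rw [Pi.add_apply, Real.norm_of_nonneg]
      positivity
    refine le_trans ?_ e1.ge
    rw [norm_mul]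
    have hn1 := norm_nonneg (bergmanFun f w)
    have hn2 := norm_nonneg (Real.log ‖w‖)
    rcases le_total ‖w‖ (1 / 2) with h | h
    · rw [hln]
      nlinarith [hM w hw h, mul_nonneg hl2 hn1]
    · nlinarith [habs (by norm_num) h hw.2, mul_nonneg hM0 hn2]
  · refine (memLp_bergmanFun f).of_le_mul (c := -Real.log r) hm ?_
    filter_upwards [ae_restrict_mem (annulus r).isOpen.measurableSet] with w hw
    rw [norm_mul]
    gcongr
    exact habs hr0 hw.1.le hw.2

/-! ### Eigenvalues of the Toeplitz operator with symbol `log |z|` -/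

theorem integral_zpow_mul_log (n : ℕ) :
    ∫ s in (0 : ℝ)..1, s ^ (2 * (n : ℤ) + 1) * Real.log s = -1 / (2 * (n : ℝ) + 2) ^ 2 := by
  have hcont : Continuous fun s : ℝ => s ^ (2 * n) * (s * Real.log s) :=
    (continuous_pow _).mul Real.continuous_mul_log
  have hint : ∀ s : ℝ, s ^ (2 * (n : ℤ) + 1) * Real.log s = s ^ (2 * n) * (s * Real.log s) := by
    intro s
    rw [show (2 * (n : ℤ) + 1) = ((2 * n + 1 : ℕ) : ℤ) by push_cast; ring, zpow_natCast, pow_succ]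
    ring
  simp only [hint]
  have hk : (2 * (n : ℝ) + 2) ≠ 0 := by positivity
  -- The antiderivative from integration by parts, written with the factor `s * Real.log s` because
  -- that is continuous at `0`.
  rw [intervalIntegral.integral_eq_sub_of_hasDerivAt_of_le (zero_le_one' ℝ)
    (f := fun s => s ^ (2 * n + 1) * (s * Real.log s) / (2 * (n : ℝ) + 2) -
      s ^ (2 * n + 2) / (2 * (n : ℝ) + 2) ^ 2) ?_ (fun s hs => ?_) (hcont.intervalIntegrable _ _)]
  · simp
    field_simp
  · have := (continuous_pow (2 * n + 1)).mul Real.continuous_mul_log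
    exact (by fun_prop : Continuous _).continuousOn
  · have h1 := (((hasDerivAt_pow (2 * n + 2) s).mul (Real.hasDerivAt_log hs.1.ne')).div_const
      (2 * (n : ℝ) + 2)).sub ((hasDerivAt_pow (2 * n + 2) s).div_const ((2 * (n : ℝ) + 2) ^ 2))
    convert! h1 using 1
    · ext x
      change _ = x ^ (2 * n + 2) * Real.log x / (2 * (n : ℝ) + 2) -
        x ^ (2 * n + 2) / (2 * (n : ℝ) + 2) ^ 2
      ring
    · have := hs.1.ne'
      push_cast
      field_simp
      ring

theorem integral_inv_mul_log {r : ℝ} (hr : 0 < r) (hr1 : r < 1) :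
    ∫ s in r..1, s ^ (2 * (-1 : ℤ) + 1) * Real.log s = -(Real.log r⁻¹) ^ 2 / 2 := by
  have hne : ∀ s ∈ Icc r 1, s ≠ 0 := fun s hs => (hr.trans_le hs.1).ne'
  have hint : IntervalIntegrable (fun s : ℝ => s ^ (2 * (-1 : ℤ) + 1) * Real.log s) volume r 1 := by
    refine ContinuousOn.intervalIntegrable ?_
    rw [uIcc_of_le hr1.le]
    exact ContinuousOn.mul
      (fun s hs => (continuousAt_zpow₀ s _ (Or.inl (hne s hs))).continuousWithinAt)
      (Real.continuousOn_log.mono hne)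
  rw [intervalIntegral.integral_eq_sub_of_hasDerivAt_of_le hr1.le
    (f := fun s => Real.log s ^ 2 / 2) (((Real.continuousOn_log.mono hne).pow 2).div_const 2)
    (fun s hs => ?_) hint]
  · rw [Real.log_one, Real.log_inv]
    ring
  · have h1 := ((Real.hasDerivAt_log (hne s (Ioo_subset_Icc_self hs))).pow 2).div_const 2
    convert! h1 using 1
    rw [show 2 * (-1 : ℤ) + 1 = -1 by norm_num, zpow_neg_one]
    push_cast
    ring

theorem inner_toeplitz_logSymbol {r : ℝ} (hr : 0 ≤ r) {ι : Type*} {ν : ι → ℤ}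
    {e : HilbertBasis ι ℂ (bergmanSpace (annulus r))}
    (he : ∀ (h : ℝ → ℝ), ContinuousOn h (Ioo r 1) → ∀ (f : bergmanSpace (annulus r))
      (hf : MemLp (fun w => h ‖w‖ * bergmanFun f w) 2 (volume.restrict (annulus r : Set ℂ))) i,
      inner ℂ (e i) (bergmanProj (annulus r) (hf.toLp _)) =
        ((2 * Real.pi * ∫ s in r..1, s ^ (2 * ν i + 1) * h s) / monomialNormSq r (ν i) : ℝ) *
          inner ℂ (e i) f) (f : bergmanSpace (annulus r)) (i : ι) :
    inner ℂ (e i) (toeplitz (annulus r) logSymbol f) =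
      ((2 * Real.pi * ∫ s in r..1, s ^ (2 * ν i + 1) * Real.log s) / monomialNormSq r (ν i) : ℝ) *
        inner ℂ (e i) f := by
  obtain ⟨h, hT⟩ := isToeplitzOperator_toeplitz_logSymbol hr f
  rw [hT]
  exact he Real.log (Real.continuousOn_log.mono fun s hs => (hr.trans_lt hs.1).ne') f h i

theorem monomialNormSq_zero_natCast (n : ℕ) :
    monomialNormSq 0 n = Real.pi / ((n : ℝ) + 1) := by
  rw [monomialNormSq_of_ne (Or.inr (by positivity)), zero_zpow _ (by omega)]
  push_cast
  ring

/-- On the punctured disc, the Toeplitz operator with symbol `log |z|` is compact and diagonal in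
the orthonormal basis of normalized monomials. -/
theorem toeplitz_logSymbol_annulus_zero :
    IsCompactOperator (toeplitz (annulus 0) logSymbol) ∧
      ∃ e : HilbertBasis ℕ ℂ (bergmanSpace (annulus 0)),
        (∀ n : ℕ, ∀ z ∈ annulus 0,
          bergmanFun (e n) z = (Real.sqrt (((n : ℝ) + 1) / Real.pi) : ℂ) * z ^ n) ∧
        ∀ n : ℕ, toeplitz (annulus 0) logSymbol (e n) = (-1 / (2 * (n : ℂ) + 2)) • e n := by
  obtain ⟨e, he, hd⟩ := exists_hilbertBasis_monomials le_rfl one_pos (fun n : ℕ => (n : ℤ))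
    Nat.cast_injective natCast_index_iff
  have hT : ∀ f n, inner ℂ (e n) (toeplitz (annulus 0) logSymbol f) =
      (-1 / (2 * (n : ℂ) + 2)) * inner ℂ (e n) f := fun f n => by
    -- The eigenvalue is `2π · (-1/(2n+2)²) · (n+1)/π = -1/(2n+2)`.
    rw [inner_toeplitz_logSymbol le_rfl hd, integral_zpow_mul_log, monomialNormSq_zero_natCast]
    congr 1
    have h1 : (2 * (n : ℂ) + 2) ≠ 0 := by
      have : (2 * (n : ℝ) + 2) ≠ 0 := by positivity
      exact_mod_cast this
    have h2 : ((n : ℂ) + 1) ≠ 0 := Nat.cast_add_one_ne_zero n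
    have h3 : (Real.pi : ℂ) ≠ 0 := Complex.ofReal_ne_zero.2 Real.pi_ne_zero
    push_cast
    field_simp
  refine ⟨isCompactOperator_of_diagonal e _ _ hT ?_, e, fun n z hz => ?_, fun n => ?_⟩
  · rw [tendsto_zero_iff_norm_tendsto_zero]
    refine squeeze_zero (fun _ => norm_nonneg _) (fun n => ?_)
      (tendsto_one_div_add_atTop_nhds_zero_nat (𝕜 := ℝ))
    have h1 : ‖(2 * (n : ℂ) + 2)‖ = 2 * (n : ℝ) + 2 := by
      have : (2 * (n : ℂ) + 2) = ((2 * n + 2 : ℕ) : ℂ) := by push_cast; ring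
      rw [this, Complex.norm_natCast]
      push_cast
      ring
    rw [norm_div, norm_neg, norm_one, h1]
    exact one_div_le_one_div_of_le (by positivity) (by linarith [n.cast_nonneg (α := ℝ)])
  · rw [he n z hz, monomialNormSq_zero_natCast, ← Real.sqrt_inv, inv_div, zpow_natCast]
  · refine e.eq_of_inner_eq fun i => ?_
    rw [hT, inner_smul_right (e i)]
    have h := orthonormal_iff_ite.1 e.orthonormal i n
    by_cases hin : i = n
    · rw [hin]
    · rw [h, if_neg hin, mul_zero, mul_zero]

/-! ### Kernel bounds on annuli and blow-up of the norms -/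

/-- In `K(z,z) = ∑ |z|^(2n)/‖zⁿ‖²` the terms with `n ≥ 0` and those with `n ≤ -2` each sum to at
most a constant independent of `r`; the term `n = -1` is kept exactly. The condition `r ≤ |z|²`
keeps `z` far from the inner circle. -/
theorem exists_norm_bergmanKernelFun_annulus_sq_le : ∃ C : ℝ, 0 < C ∧ ∀ (r : ℝ), 0 < r →
    ∀ z ∈ annulus r, ‖z‖ ≤ 1 / 2 → r ≤ ‖z‖ ^ 2 →
      ‖bergmanKernelFun (annulus r) z‖ ^ 2 ≤ C + (‖z‖ ^ 2)⁻¹ / (2 * Real.pi * Real.log r⁻¹) := by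
  have hsum := summable_succ_mul_geometric
  set C₀ := ∑' n : ℕ, ((n : ℝ) + 1) * (1 / 4) ^ n with hC₀
  have hC₀pos : 0 < C₀ := hsum.tsum_pos (fun n => by positivity) 0 (by norm_num)
  refine ⟨C₀ + C₀, by positivity, fun r hr z hz hz2 hrz => ?_⟩
  have hz0 : 0 < ‖z‖ := hr.trans hz.1
  have hr4 : r ≤ 1 / 4 := hrz.trans (by nlinarith)
  have hr1 : r < 1 := by linarith
  obtain ⟨e, he, -⟩ := exists_hilbertBasis_monomials hr.le hr1 (fun n : ℤ => n)
    Function.injective_id (fun n => ⟨fun _ => Or.inl hr, fun _ => ⟨n, rfl⟩⟩)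
  have h := hasSum_norm_bergmanFun_sq e z
  have hterm : ∀ n : ℤ, ‖bergmanFun (e n) z‖ ^ 2 = ‖z‖ ^ (2 * n) / monomialNormSq r n := fun n => by
    rw [he n z hz, norm_normalized_zpow_sq hr.le hr1 (Or.inl hr)]
  simp only [hterm] at h
  have hs1 : Summable fun n : ℕ => ‖z‖ ^ (2 * (n : ℤ)) / monomialNormSq r n :=
    h.summable.comp_injective (i := fun n : ℕ => (n : ℤ)) Nat.cast_injective
  have hs2 : Summable fun n : ℕ =>
      ‖z‖ ^ (2 * (-((n : ℤ) + 1))) / monomialNormSq r (-((n : ℤ) + 1)) :=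
    h.summable.comp_injective (i := fun n : ℕ => -((n : ℤ) + 1)) fun a b hab => by
      simpa using hab
  have htot := h.unique (hs1.hasSum.of_nat_of_neg_add_one
    (f := fun n : ℤ => ‖z‖ ^ (2 * n) / monomialNormSq r n) hs2.hasSum)
  -- Index `0` of the negative family is the exponent `-1`, split off here.
  rw [htot, hs2.tsum_eq_zero_add]
  have hb1 : ∑' n : ℕ, ‖z‖ ^ (2 * (n : ℤ)) / monomialNormSq r n ≤ C₀ :=
    hs1.tsum_le_tsum (fun n => zpow_div_monomialNormSq_natCast_le hr.le (by linarith) hz0.le hz2 n)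
      hsum
  have hb2 : ∑' n : ℕ, ‖z‖ ^ (2 * (-(((n + 1 : ℕ) : ℤ) + 1))) /
      monomialNormSq r (-(((n + 1 : ℕ) : ℤ) + 1)) ≤ C₀ :=
    ((summable_nat_add_iff 1).2 hs2).tsum_le_tsum
      (fun n => zpow_div_monomialNormSq_neg_le hr hz2 hz0 hrz n) hsum
  have hb3 : ‖z‖ ^ (2 * (-(((0 : ℕ) : ℤ) + 1))) / monomialNormSq r (-(((0 : ℕ) : ℤ) + 1)) =
      (‖z‖ ^ 2)⁻¹ / (2 * Real.pi * Real.log r⁻¹) := by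
    have : -(((0 : ℕ) : ℤ) + 1) = -1 := by norm_num
    rw [this, monomialNormSq_neg_one hr, show 2 * (-1 : ℤ) = -((2 : ℕ) : ℤ) by norm_num, zpow_neg,
      zpow_natCast]
  rw [hb3]
  linarith

/-- The `z⁻¹` component of the kernel alone gives a lower bound for the Berezin transform. -/
theorem le_norm_berezin_annulus {r : ℝ} (hr : 0 < r) (hr1 : r < 1) {z : ℂ} (hz : z ∈ annulus r) :
    (‖z‖ ^ 2)⁻¹ / (4 * Real.pi * ‖bergmanKernelFun (annulus r) z‖ ^ 2) ≤
      ‖berezin (annulus r) (toeplitz (annulus r) logSymbol) z‖ := by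
  obtain ⟨e, he, hd⟩ := exists_hilbertBasis_monomials hr.le hr1 (fun n : ℤ => n)
    Function.injective_id (fun n => ⟨fun _ => Or.inl hr, fun _ => ⟨n, rfl⟩⟩)
  set T := toeplitz (annulus r) logSymbol with hTdef
  set k := normalizedBergmanKernel (annulus r) z with hk
  set c : ℤ → ℝ := fun n =>
    (2 * Real.pi * ∫ s in r..1, s ^ (2 * n + 1) * Real.log s) / monomialNormSq r n with hc
  -- `log ≤ 0` on `(r, 1)`, so every eigenvalue is nonpositive and a single term of the Berezin
  -- series bounds the whole from below.
  have hc0 : ∀ n, 0 ≤ -c n := fun n => by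
    rw [hc]
    simp only
    rw [← neg_div, ← mul_neg, ← intervalIntegral.integral_neg]
    refine div_nonneg (mul_nonneg Real.two_pi_pos.le
      (intervalIntegral.integral_nonneg hr1.le fun s hs => ?_))
      (monomialNormSq_pos hr.le hr1 (Or.inl hr)).le
    rw [← mul_neg]
    exact mul_nonneg (zpow_nonneg (hr.le.trans hs.1) _)
      (neg_nonneg.2 (Real.log_nonpos (hr.le.trans hs.1) hs.2))
  have hsum : HasSum (fun n => -c n * ‖(inner ℂ (e n) k : ℂ)‖ ^ 2)
      (-berezin (annulus r) T z).re := by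
    have h1 := (e.hasSum_inner_mul_inner k (T k)).neg
    have h2 := Complex.hasSum_re h1
    convert! h2 using 2 with n
    rw [hTdef, inner_toeplitz_logSymbol hr.le hd, ← inner_conj_symm (𝕜 := ℂ) k (e n)]
    rw [mul_left_comm, Complex.conj_mul', neg_mul, Complex.neg_re]
    rw [← Complex.ofReal_pow, ← Complex.ofReal_mul, Complex.ofReal_re]
  have hle := (le_hasSum hsum (-1) fun n _ => mul_nonneg (hc0 n) (sq_nonneg _)).trans
    (Complex.re_le_norm _)
  rw [norm_neg] at hle
  refine le_trans (le_of_eq ?_) hle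
  have hL : 0 < Real.log r⁻¹ := Real.log_pos ((one_lt_inv₀ hr).2 hr1)
  have h1 : ‖(inner ℂ (e (-1)) k : ℂ)‖ ^ 2 =
      (‖z‖ ^ 2)⁻¹ / (2 * Real.pi * Real.log r⁻¹) / ‖bergmanKernelFun (annulus r) z‖ ^ 2 := by
    rw [hk, normalizedBergmanKernel_eq, inner_smul_right (e (-1)), norm_mul, mul_pow, norm_inv,
      Complex.norm_real, norm_norm, norm_inner_symm (𝕜 := ℂ) (e (-1)), inner_bergmanKernelFun,
      he (-1) z hz, norm_normalized_zpow_sq hr.le hr1 (Or.inl hr), monomialNormSq_neg_one hr,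
      show 2 * (-1 : ℤ) = -((2 : ℕ) : ℤ) by norm_num, zpow_neg, zpow_natCast, inv_pow,
      inv_mul_eq_div]
  -- The factor `log r⁻¹` in this eigenvalue cancels the one in `‖z⁻¹‖²`.
  have h2 : c (-1) = -(Real.log r⁻¹ / 2) := by
    rw [hc]
    simp only
    rw [integral_inv_mul_log hr hr1, monomialNormSq_neg_one hr]
    have := Real.pi_ne_zero
    field_simp
  rw [h1, h2]
  have := Real.pi_ne_zero
  have hL' := hL.ne'
  generalize Real.log r⁻¹ = L at hL'
  field_simp
  ring

/-- The logarithmic divergence as `a → 0` is what makes the norms blow up. -/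
theorem lintegral_inv_norm_sq_annulus {a b : ℝ} (ha : 0 < a) (hab : a ≤ b) {c : ℝ} (hc : 0 ≤ c) :
    ∫⁻ w in {w : ℂ | a < ‖w‖ ∧ ‖w‖ < b}, ENNReal.ofReal (c * (‖w‖ ^ 2)⁻¹) =
      ENNReal.ofReal (c * (2 * Real.pi * Real.log (b / a))) := by
  set S : Set ℂ := {w : ℂ | a < ‖w‖ ∧ ‖w‖ < b} with hS
  have hSm : MeasurableSet S := ((isOpen_lt continuous_const continuous_norm).inter
    (isOpen_lt continuous_norm continuous_const)).measurableSet
  have hne : ∀ w ∈ S, ‖w‖ ^ 2 ≠ 0 := fun w hw => (pow_pos (ha.trans hw.1) 2).ne'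
  have hcont : ContinuousOn (fun w : ℂ => (‖w‖ ^ 2)⁻¹) S :=
    ContinuousOn.inv₀ (by fun_prop) hne
  have hfin : volume S ≠ ∞ := ((measure_mono fun w hw => mem_ball_zero_iff.2 hw.2).trans_lt
    (measure_ball_lt_top (μ := volume) (x := (0 : ℂ)) (r := b))).ne
  have hint : IntegrableOn (fun w : ℂ => (‖w‖ ^ 2)⁻¹) S := by
    refine Measure.integrableOn_of_bounded (M := (a ^ 2)⁻¹) hfin
      (by fun_prop) ?_
    filter_upwards [ae_restrict_mem hSm] with w hw
    rw [norm_inv, norm_pow, norm_norm]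
    have := hw.1
    gcongr
  have hval : ∫ w in S, (‖w‖ ^ 2)⁻¹ = 2 * Real.pi * Real.log (b / a) := by
    have h1 := integral_annulus_eq_circleAverage (F := fun w => (((‖w‖ ^ 2)⁻¹ : ℝ) : ℂ)) ha.le hab
      (Complex.continuous_ofReal.comp_continuousOn hcont) hint.ofReal
    rw [integral_complex_ofReal] at h1
    have h2 : ∫ s in a..b, (s : ℂ) * Real.circleAverage (fun w => (((‖w‖ ^ 2)⁻¹ : ℝ) : ℂ)) 0 s =
        ∫ s in a..b, ((s⁻¹ : ℝ) : ℂ) := by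
      refine intervalIntegral.integral_congr fun s hs => ?_
      rw [uIcc_of_le hab] at hs
      have hs0 : 0 < s := ha.trans_le hs.1
      rw [Real.circleAverage_congr_sphere (f₂ := fun _ => (((s ^ 2)⁻¹ : ℝ) : ℂ)),
        Real.circleAverage_const, ← Complex.ofReal_mul]
      · congr 1
        field_simp
      · intro w hw
        rw [mem_sphere_zero_iff_norm, abs_of_pos hs0] at hw
        simp only [hw]
    rw [h2, intervalIntegral.integral_ofReal, integral_inv_of_pos ha (ha.trans_le hab)] at h1
    exact_mod_cast h1
  rw [← hval, ← integral_const_mul, ofReal_integral_eq_lintegral_ofReal (hint.const_mul c)]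
  exact Eventually.of_forall fun w => by positivity

theorem exists_le_eLpNorm_one_berezin : ∃ c : ℝ, 0 < c ∧ ∀ᶠ r : ℝ in 𝓝[>] 0,
    ENNReal.ofReal (c * (2 * Real.pi * Real.log (Real.sqrt (Real.log r⁻¹) / 2))) ≤
      eLpNorm (zeroExtension (annulus r)
        (berezin (annulus r) (toeplitz (annulus r) logSymbol))) 1
        (volume.restrict (annulus 0 : Set ℂ)) := by
  obtain ⟨C, hC, hK⟩ := exists_norm_bergmanKernelFun_annulus_sq_le
  have hpi := Real.pi_pos
  -- With `K(w,w) ≤ C + 1/(2π)`, the denominator `4π K(w,w)` is at most `4πC + 2`.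
  refine ⟨(4 * Real.pi * C + 2)⁻¹, by positivity, ?_⟩
  have hlog : Tendsto (fun r : ℝ => Real.log r⁻¹) (𝓝[>] 0) atTop :=
    Real.tendsto_log_atTop.comp tendsto_inv_nhdsGT_zero
  filter_upwards [hlog.eventually_ge_atTop 4, self_mem_nhdsWithin] with r hL4 hr
  have hr0 : (0 : ℝ) < r := hr
  set L := Real.log r⁻¹ with hL
  have hL0 : 0 < L := by linarith
  -- For `|w| ≥ a = L^(-1/2)` the `n = -1` term of the kernel is at most `1/(2π)`; `L ≥ 4` gives `a
  -- ≤ 1/2`.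
  set a := (Real.sqrt L)⁻¹ with ha
  have hsq : 2 ≤ Real.sqrt L := Real.le_sqrt_of_sq_le (by linarith)
  have ha0 : 0 < a := by positivity
  have ha2 : a ≤ 1 / 2 := by
    rw [ha, inv_le_comm₀ (by positivity) (by norm_num)]
    linarith
  have hasq : a ^ 2 = L⁻¹ := by rw [ha, inv_pow, Real.sq_sqrt hL0.le]
  -- Equivalent to `log r⁻¹ ≤ r⁻¹`; it ensures `r ≤ |w|²`, as the kernel bound requires.
  have hra : r ≤ a ^ 2 := by
    rw [hasq, le_inv_comm₀ hr0 hL0]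
    exact (Real.log_le_sub_one_of_pos (inv_pos.2 hr0)).trans (by linarith)
  have hr1 : r < 1 := hra.trans_lt (by nlinarith)
  have hra' : r ≤ a := hra.trans (by nlinarith)
  rw [eLpNorm_one_eq_lintegral_enorm, show Real.sqrt L / 2 = (1 / 2) / a by
    rw [ha, div_inv_eq_mul]; ring, ← lintegral_inv_norm_sq_annulus ha0 ha2 (by positivity)]
  have hsub : {w : ℂ | a < ‖w‖ ∧ ‖w‖ < 1 / 2} ⊆ annulus 0 := fun w hw =>
    ⟨ha0.trans hw.1, hw.2.trans (by norm_num)⟩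
  refine le_trans ?_ (lintegral_mono_set hsub)
  refine setLIntegral_mono' ((isOpen_lt continuous_const continuous_norm).inter
    (isOpen_lt continuous_norm continuous_const)).measurableSet fun w hw => ?_
  have hw0 : 0 < ‖w‖ := ha0.trans hw.1
  have hwr : w ∈ annulus r := ⟨hra'.trans_lt hw.1, hw.2.trans (by norm_num)⟩
  rw [zeroExtension, indicator_of_mem hwr, ← ofReal_norm]
  refine ENNReal.ofReal_le_ofReal (le_trans ?_ (le_norm_berezin_annulus hr0 hr1 hwr))
  have haw : a ^ 2 ≤ ‖w‖ ^ 2 := by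
    have := hw.1.le
    gcongr
  have hKw := hK r hr0 w hwr hw.2.le (hra.trans haw)
  have hwL : (‖w‖ ^ 2)⁻¹ / (2 * Real.pi * L) ≤ 1 / (2 * Real.pi) := by
    rw [div_le_div_iff₀ (by positivity) (by positivity), one_mul]
    have h1 : (‖w‖ ^ 2)⁻¹ ≤ L := by
      rw [inv_le_comm₀ (by positivity) hL0, ← hasq]
      exact haw
    nlinarith
  -- The kernel function is nonzero because it reproduces the constant function `1`.
  have hKpos : 0 < ‖bergmanKernelFun (annulus r) w‖ := by
    rw [norm_pos_iff]
    intro h0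
    have h1 := inner_bergmanKernelFun (annulus r) w (bergmanMk
      (differentiableOn_zpow_annulus hr0.le 0) (memLp_zpow_annulus hr0.le (Or.inl hr0)))
    rw [h0, bergmanFun_bergmanMk _ _ hwr, zpow_zero] at h1
    rw [inner_zero_left] at h1
    exact zero_ne_one h1
  rw [inv_mul_eq_div]
  gcongr
  calc 4 * Real.pi * ‖bergmanKernelFun (annulus r) w‖ ^ 2 ≤
        4 * Real.pi * (C + 1 / (2 * Real.pi)) := by
        gcongr
        linarith
    _ = 4 * Real.pi * C + 2 := by
        field_simp
        ring

/-- The punctured disc has finite measure, so by Hölder the `L¹` norm is at most the `L^p` norm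
times a constant `κ` independent of `r`. -/
theorem tendsto_eLpNorm_zeroExtension_berezin {p : ℝ≥0∞} (hp : 1 ≤ p) :
    Tendsto (fun r : ℝ => eLpNorm (zeroExtension (annulus r)
      (berezin (annulus r) (toeplitz (annulus r) logSymbol))) p
      (volume.restrict (annulus 0 : Set ℂ))) (𝓝[>] 0) (𝓝 ∞) := by
  obtain ⟨c, hc, hle⟩ := exists_le_eLpNorm_one_berezin
  have hlog : Tendsto (fun r : ℝ => Real.log r⁻¹) (𝓝[>] 0) atTop :=
    Real.tendsto_log_atTop.comp tendsto_inv_nhdsGT_zero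
  have h1 : Tendsto (fun r : ℝ =>
      c * (2 * Real.pi * Real.log (Real.sqrt (Real.log r⁻¹) / 2))) (𝓝[>] 0) atTop :=
    ((Real.tendsto_log_atTop.comp ((Real.tendsto_sqrt_atTop.comp hlog).atTop_div_const
      two_pos)).const_mul_atTop Real.two_pi_pos).const_mul_atTop hc
  have h2 := ENNReal.tendsto_ofReal_atTop.comp h1
  set μ := volume.restrict (annulus 0 : Set ℂ) with hμ
  have hκ : μ univ ^ (1 / (1 : ℝ≥0∞).toReal - 1 / p.toReal) ≠ ∞ := by
    refine ENNReal.rpow_ne_top_of_nonneg ?_ (measure_ne_top μ univ)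
    rw [ENNReal.toReal_one, div_one, sub_nonneg]
    -- For `p = ∞` the conventions `∞.toReal = 0` and `1 / 0 = 0` give the exponent `1`, as they
    -- should.
    rcases eq_or_ne p ∞ with rfl | hpt
    · simp
    · have : 1 ≤ p.toReal := by
        rw [← ENNReal.toReal_one]
        exact ENNReal.toReal_mono hpt hp
      exact (div_le_one (by linarith)).2 this
  set κ := μ univ ^ (1 / (1 : ℝ≥0∞).toReal - 1 / p.toReal) with hκdef
  rw [ENNReal.tendsto_nhds_top_iff_nnreal]
  intro x
  filter_upwards [hle, self_mem_nhdsWithin,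
    h2.eventually (lt_mem_nhds (show (x : ℝ≥0∞) * κ < ∞ from
      ENNReal.mul_lt_top ENNReal.coe_lt_top hκ.lt_top))] with r hr hr0 hx
  have hsub : (annulus r : Set ℂ) ⊆ annulus 0 := fun z hz => ⟨(mem_Ioi.1 hr0).trans hz.1, hz.2⟩
  have hm := (memLp_zeroExtension_berezin hsub (toeplitz (annulus r) logSymbol) 1).1
  have h3 := (hx.trans_le hr).trans_le (eLpNorm_le_eLpNorm_mul_rpow_measure_univ hp hm)
  exact lt_of_mul_lt_mul_right' h3

end

/-! ### Assembly -/

theorem mainTheorem7 :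
    -- `T_φ` is a compact operator on `A²(𝔻*)`, diagonal in the orthonormal basis `zⁿ / ‖zⁿ‖`
    (IsToeplitzOperator puncturedDisc logSymbol (toeplitz puncturedDisc logSymbol) ∧
      IsCompactOperator (toeplitz puncturedDisc logSymbol) ∧
      ∃ e : HilbertBasis ℕ ℂ (bergmanSpace puncturedDisc),
        (∀ n : ℕ, ∀ z ∈ puncturedDisc,
          bergmanFun (e n) z = (Real.sqrt (((n : ℝ) + 1) / Real.pi) : ℂ) * z ^ n) ∧
        ∀ n : ℕ, toeplitz puncturedDisc logSymbol (e n) = (-1 / (2 * (n : ℂ) + 2)) • e n) ∧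
    -- the norms on the annuli blow up
    (∀ r ∈ Ioo (0 : ℝ) 1,
      IsToeplitzOperator (annulus r) logSymbol (toeplitz (annulus r) logSymbol)) ∧
    (∀ p : ℝ≥0∞, 1 ≤ p →
      (∀ r ∈ Ioo (0 : ℝ) 1,
        MemLp (zeroExtension (annulus r) (berezin (annulus r) (toeplitz (annulus r) logSymbol)))
          p (volume.restrict (puncturedDisc : Set ℂ))) ∧
      Tendsto (fun r : ℝ =>
        eLpNorm (zeroExtension (annulus r) (berezin (annulus r) (toeplitz (annulus r) logSymbol)))
          p (volume.restrict (puncturedDisc : Set ℂ))) (𝓝[>] 0) (𝓝 ∞)) ∧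
    -- while the limit operator has a Berezin transform in every `L^p`
    (∀ p : ℝ≥0∞, 1 ≤ p →
      MemLp (berezin puncturedDisc (toeplitz puncturedDisc logSymbol)) p
        (volume.restrict (puncturedDisc : Set ℂ))) := by
  rw [puncturedDisc_eq_annulus]
  refine ⟨⟨isToeplitzOperator_toeplitz_logSymbol le_rfl, toeplitz_logSymbol_annulus_zero⟩,
    fun r hr => isToeplitzOperator_toeplitz_logSymbol hr.1.le, fun p hp => ⟨fun r hr => ?_,
      tendsto_eLpNorm_zeroExtension_berezin hp⟩, fun p _ => ?_⟩
  · have hsub : (annulus r : Set ℂ) ⊆ annulus 0 := fun z hz => ⟨hr.1.trans hz.1, hz.2⟩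
    exact memLp_zeroExtension_berezin hsub _ p
  · exact MemLp.of_bound (aestronglyMeasurable_berezin _ _) _
      (Eventually.of_forall fun z => norm_berezin_le _ _ z)
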